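/- Let $n\ge 1$ and $[n]=\{1,\dots,n\}$ with its usual order $<$. An orientation is a triple $\delta=(n,\delta^+,\delta^-)$ with $\delta^+,\delta^-\subseteq[n]$ arbitrary. A *$\delta$-permutree* is a directed tree $T$ with vertex set $[n]$ such that: every $b\in\delta^+$ has at most one outgoing neighbor (parent) smaller than $b$ and at most one larger than $b$, and all labels of the connected component of $T\smallsetminus b$ containing the smaller (resp. larger) parent are smaller (resp. larger) than $b$; every $b\notin\delta^+$ has at most one parent; and the same holds with incoming neighbors (children) and $\delta^-$ in place of parents and $\delta^+$. Write $i\prec_T j$ if there is an oriented path (possibly of length $0$) from $i$ to $j$ in $T$. The *weak order* on permutations of $[n]$ is $\sigma\le\tau\iff \mathrm{inv}(\sigma)\subseteq\mathrm{inv}(\tau)$, where $\mathrm{inv}(\sigma)=\{(b,a): a\le b,\ \sigma^{-1}(a)\ge\sigma^{-1}(b)\}$. For $\delta$-permutrees, $T\le T'$ means that there are linear extensions $\sigma$ of $\prec_T$ and $\sigma'$ of $\prec_{T'}$ (each viewed as the permutation listing it) with $\sigma\le\sigma'$. For $T\le T'$, let $\prec_{[T,T']}$ be the intersection of the relations $\prec_{U}$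 over all $\delta$-permutrees $U$ with $T\le U\le T'$, and let $$\mathrm{PIP}(\delta)=\{\prec_{[T,T']} : T\le T'\ \text{$\delta$-permutrees}\}.$$ For $X\subseteq[n]$, the intervals of $[n]\smallsetminus X$ are its maximal sets of consecutive integers; for an interval $I=[i,j]$ let $\bar I=[i-1,j+1]$. A *Schröder $\delta$-permutree* is a directed tree $S$ whose vertices $v$ are labeled by nonempty sets $p(v)$ that partition $[n]$, such that each vertex $v$ has one (possibly empty) outgoing subtree for each interval $I$ of $[n]\smallsetminus(p(v)\cap\delta^+)$ and one (possibly empty) incoming subtree for each interval $I$ of $[n]\smallsetminus(p(v)\cap\delta^-)$, all labels in that subtree being subsets of $I$. (The outgoing, resp. incoming, subtrees of $v$ are the components of $S\smallsetminus v$ attached to $v$ by outgoing, resp. incoming, edges.) For an edge $v\to w$ of $S$ let $I_v^w$ be the interval of $[n]\smallsetminus(p(v)\cap\delta^+)$ containing $p(w)$ and $J_v^w$ the interval of $[n]\smallsetminus(p(w)\cap\delta^-)$ containing $p(v)$. Let $T^{\min}(S)$ be the $\delta$-permutree whose edges are $x\to y$ for all consecutive elements $x<y$ of each $p(v)$, and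 $\max(p(v)\cap\bar I_v^w)\to\min(p(w)\cap\bar J_v^w)$ for each edge $v\to w$ of $S$. Let $T^{\max}(S)$ be the $\delta$-permutree whose edges are $y\to x$ for all consecutive elements $x<y$ of each $p(v)$, and $\min(p(v)\cap\bar I_v^w)\to\max(p(w)\cap\bar J_v^w)$ for each edge $v\to w$ of $S$. Put $\prec_S\,=\,\prec_{[T^{\min}(S),T^{\max}(S)]}$ and $$\mathrm{PFP}(\delta)=\{\prec_S : S\ \text{a Schröder $\delta$-permutree}\}.$$ **Proposition.** Let $\delta$ be an orientation of $[n]$ and let $\prec$ be a (reflexive, transitive, antisymmetric) partial order on $[n]$; write $x\succ y$ for $y\prec x$. Then $\prec$ belongs to $\mathrm{PFP}(\delta)$ if and only if $\prec$ belongs to $\mathrm{PIP}(\delta)$ and every pair $a<c$ that is incomparable in $\prec$ satisfies $(\spadesuit)$ or $(\clubsuit)$, where * $(\spadesuit)$: there is $b$ with $a<b<c$ such that either $b\in\delta^+$ and $a\not\prec b\not\succ c$, or $b\in\delta^-$ and $a\not\succ b\not\prec c$; * $(\clubsuit)$: for all $b$ with $a<b<c$, we have $a\prec b\iff b\succ c$,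 and $a\succ b\iff b\prec c$. -/

import Mathlib

/-! The ground set `[n]` is modelled by `Fin n` with its usual order (values shifted by one).
An orientation of `[n]` is a pair of arbitrary subsets `pos` and `neg` of `Fin n`.
All relations are binary predicates on `Fin n`; `R i j` is read "`i` precedes `j`". -/

namespace PermutreePosets

/-- An orientation `δ = (n, δ⁺, δ⁻)`: two arbitrary subsets of `[n]`. -/
structure Orient (n : ℕ) where
  pos : Set (Fin n)
  neg : Set (Fin n)

/-! ### Directed trees -/

section Trees

variable {V : Type}

/-- A directed tree: each edge carries exactly one direction, and the underlying undirected
simple graph is a tree. -/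
def IsDirectedTree (T : Digraph V) : Prop :=
  (∀ v w, T.Adj v w → ¬ T.Adj w v) ∧ T.toSimpleGraphInclusive.IsTree

/-- The vertices of the subtree of `T` attached to `v` through its neighbor `w`: the vertices
that are joined to `w` by an undirected walk avoiding `v`. If `w` is a parent (outgoing neighbor)
of `v` this is an ancestor subtree of `v`; if `w` is a child (incoming neighbor) of `v`, this is a
descendant subtree of `v`. -/
def subtree (T : Digraph V) (v w : V) : Set V :=
  {x | ∃ q : T.toSimpleGraphInclusive.Walk w x, v ∉ q.support}

end Trees

/-! ### Permutrees -/

section Permutrees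

variable {n : ℕ}

/-- `T` is a `δ`-permutree. Vertices are identified with their labels in `[n]`, and empty
parents and children (the dangling edges) are not recorded as vertices, so "two parents" means
"a possibly empty left ancestor subtree and a possibly empty right ancestor subtree".
* A vertex `b ∈ δ⁺` has two parents: all labels in its left (right) ancestor subtree are
  smaller (larger) than `b`. A vertex `b ∉ δ⁺` has one parent.
* Likewise for children and `δ⁻`. -/
structure IsPermutree (δ : Orient n) (T : Digraph (Fin n)) : Prop where
  isDirectedTree : IsDirectedTree T
  one_parent : ∀ b, b ∉ δ.pos → ∀ u v, T.Adj b u → T.Adj b v → u = v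
  left_parent : ∀ b ∈ δ.pos, ∀ u v, T.Adj b u → T.Adj b v → u < b → v < b → u = v
  right_parent : ∀ b ∈ δ.pos, ∀ u v, T.Adj b u → T.Adj b v → b < u → b < v → u = v
  left_ancestor : ∀ b ∈ δ.pos, ∀ u, T.Adj b u → u < b → ∀ x ∈ subtree T b u, x < b
  right_ancestor : ∀ b ∈ δ.pos, ∀ u, T.Adj b u → b < u → ∀ x ∈ subtree T b u, b < x
  one_child : ∀ b, b ∉ δ.neg → ∀ u v, T.Adj u b → T.Adj v b → u = v
  left_child : ∀ b ∈ δ.neg, ∀ u v, T.Adj u b → T.Adj v b → u < b → v < b → u = v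
  right_child : ∀ b ∈ δ.neg, ∀ u v, T.Adj u b → T.Adj v b → b < u → b < v → u = v
  left_descendant : ∀ b ∈ δ.neg, ∀ u, T.Adj u b → u < b → ∀ x ∈ subtree T b u, x < b
  right_descendant : ∀ b ∈ δ.neg, ∀ u, T.Adj u b → b < u → ∀ x ∈ subtree T b u, b < x

/-- The relation `≺_T`: there is an oriented path from `i` to `j` in `T`. -/
def treeRel (T : Digraph (Fin n)) : Fin n → Fin n → Prop :=
  Relation.ReflTransGen T.Adj

/-- The inversions `(b, a)` of a permutation, where `σ i` is the value at position `i`. -/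
def inversions (σ : Equiv.Perm (Fin n)) : Set (Fin n × Fin n) :=
  {z | z.2 ≤ z.1 ∧ σ⁻¹ z.1 ≤ σ⁻¹ z.2}

/-- The weak order on permutations: inclusion of inversions. -/
def weakOrderLE (σ τ : Equiv.Perm (Fin n)) : Prop :=
  inversions σ ⊆ inversions τ

/-- `σ` is a linear extension of the relation `R`. -/
def IsLinearExtension (σ : Equiv.Perm (Fin n)) (R : Fin n → Fin n → Prop) : Prop :=
  ∀ u v, R u v → σ⁻¹ u ≤ σ⁻¹ v

/-- The permutree order: `T ≤ T'` if there are linear extensions `σ` of `≺_T` and `σ'` of `≺_T'`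
such that `σ ≤ σ'` in weak order. -/
def permutreeLE (T T' : Digraph (Fin n)) : Prop :=
  ∃ σ σ' : Equiv.Perm (Fin n),
    IsLinearExtension σ (treeRel T) ∧ IsLinearExtension σ' (treeRel T') ∧ weakOrderLE σ σ'

/-- The relation `≺_[T,T']`: the intersection of the relations `≺_S` over all `δ`-permutrees `S`
with `T ≤ S ≤ T'`. -/
def intervalRel (δ : Orient n) (T T' : Digraph (Fin n)) : Fin n → Fin n → Prop :=
  fun i j => ∀ S : Digraph (Fin n),
    IsPermutree δ S → permutreeLE T S → permutreeLE S T' → treeRel S i j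

/-- `PIP(δ)`, the set of `δ`-permutree interval posets. -/
def PIP (δ : Orient n) : Set (Fin n → Fin n → Prop) :=
  {R | ∃ T T' : Digraph (Fin n),
    IsPermutree δ T ∧ IsPermutree δ T' ∧ permutreeLE T T' ∧ R = intervalRel δ T T'}

end Permutrees

/-! ### Schröder permutrees -/

section Schroder

variable {n : ℕ} {V : Type}

/-- The (nonempty) intervals of `[n] ∖ X`, that is, its maximal sets of consecutive integers. -/
def intervalsOfCompl (X : Set (Fin n)) : Set (Set (Fin n)) :=
  {I | ∃ y, y ∉ X ∧ I = Set.ordConnectedComponent Xᶜ y}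

/-- For an interval `I = [i, j]`, the elements of `[n]` in `[i - 1, j + 1]`. -/
def enlarge (I : Set (Fin n)) : Set (Fin n) :=
  {x | ∃ y ∈ I, (x : ℕ) ≤ (y : ℕ) + 1 ∧ (y : ℕ) ≤ (x : ℕ) + 1}

/-- `S`, with vertex labeling `p`, is a Schröder `δ`-permutree: the nonempty labels partition
`[n]`, and each vertex `v` has one (possibly empty) outgoing subtree for each interval `I` of
`[n] ∖ (p v ∩ δ⁺)` and one (possibly empty) incoming subtree for each interval `I` of
`[n] ∖ (p v ∩ δ⁻)`, whose labels are all contained in `I`. -/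
structure IsSchroderPermutree (δ : Orient n) (S : Digraph V) (p : V → Set (Fin n)) : Prop where
  isDirectedTree : IsDirectedTree S
  label_nonempty : ∀ v, (p v).Nonempty
  label_disjoint : ∀ v w, v ≠ w → Disjoint (p v) (p w)
  label_cover : ⋃ v, p v = Set.univ
  outgoing_subset : ∀ v w, S.Adj v w →
    ∃ I ∈ intervalsOfCompl (p v ∩ δ.pos), ∀ x ∈ subtree S v w, p x ⊆ I
  outgoing_unique : ∀ v, ∀ I ∈ intervalsOfCompl (p v ∩ δ.pos), ∀ w w',
    S.Adj v w → S.Adj v w' → p w ⊆ I → p w' ⊆ I → w = w'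
  incoming_subset : ∀ v w, S.Adj w v →
    ∃ I ∈ intervalsOfCompl (p v ∩ δ.neg), ∀ x ∈ subtree S v w, p x ⊆ I
  incoming_unique : ∀ v, ∀ I ∈ intervalsOfCompl (p v ∩ δ.neg), ∀ w w',
    S.Adj w v → S.Adj w' v → p w ⊆ I → p w' ⊆ I → w = w'

/-- `i` and `j` are consecutive elements `i < j` of `X`. -/
def Consecutive (X : Set (Fin n)) (i j : Fin n) : Prop :=
  i ∈ X ∧ j ∈ X ∧ i < j ∧ ∀ k ∈ X, ¬ (i < k ∧ k < j)

/-- The minimal permutree of the face of `S`: replace each vertex `v` by the left comb on `p v`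
(the increasing chain) and, for each edge `v → w`, join `max (p v ∩ Ī)` to `min (p w ∩ J̄)`, where
`I` (resp. `J`) is the interval of `[n] ∖ (p v ∩ δ⁺)` containing `p w` (resp. of
`[n] ∖ (p w ∩ δ⁻)` containing `p v`). -/
def minPermutree (δ : Orient n) (S : Digraph V) (p : V → Set (Fin n)) : Digraph (Fin n) where
  Adj i j := (∃ v, Consecutive (p v) i j) ∨
    ∃ v w, S.Adj v w ∧
      ∃ I ∈ intervalsOfCompl (p v ∩ δ.pos), ∃ J ∈ intervalsOfCompl (p w ∩ δ.neg),
        p w ⊆ I ∧ p v ⊆ J ∧ IsGreatest (p v ∩ enlarge I) i ∧ IsLeast (p w ∩ enlarge J) j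

/-- The maximal permutree of the face of `S`: replace each vertex `v` by the right comb on `p v`
(the decreasing chain) and, for each edge `v → w`, join `min (p v ∩ Ī)` to `max (p w ∩ J̄)`. -/
def maxPermutree (δ : Orient n) (S : Digraph V) (p : V → Set (Fin n)) : Digraph (Fin n) where
  Adj i j := (∃ v, Consecutive (p v) j i) ∨
    ∃ v w, S.Adj v w ∧
      ∃ I ∈ intervalsOfCompl (p v ∩ δ.pos), ∃ J ∈ intervalsOfCompl (p w ∩ δ.neg),
        p w ⊆ I ∧ p v ⊆ J ∧ IsLeast (p v ∩ enlarge I) i ∧ IsGreatest (p w ∩ enlarge J) j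

/-- The relation `≺_S` of a Schröder `δ`-permutree `S`: the interval relation of the interval of
`δ`-permutrees in the corresponding face. -/
def faceRel (δ : Orient n) (S : Digraph V) (p : V → Set (Fin n)) : Fin n → Fin n → Prop :=
  intervalRel δ (minPermutree δ S p) (maxPermutree δ S p)

/-- `PFP(δ)`, the set of `δ`-permutree face posets. -/
def PFP (δ : Orient n) : Set (Fin n → Fin n → Prop) :=
  {R | ∃ (V : Type) (S : Digraph V) (p : V → Set (Fin n)),
    IsSchroderPermutree δ S p ∧ R = faceRel δ S p}

end Schroder

/-! ### The two conditions on an incomparable pair -/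

section Conditions

variable {n : ℕ}

/-- Condition `(♠)` for the pair `a < c`. -/
def Spade (δ : Orient n) (R : Fin n → Fin n → Prop) (a c : Fin n) : Prop :=
  ∃ b, a < b ∧ b < c ∧
    ((b ∈ δ.pos ∧ ¬ R a b ∧ ¬ R c b) ∨ (b ∈ δ.neg ∧ ¬ R b a ∧ ¬ R b c))

/-- Condition `(♣)` for the pair `a < c`. -/
def Club (R : Fin n → Fin n → Prop) (a c : Fin n) : Prop :=
  ∀ b, a < b → b < c → ((R a b ↔ R c b) ∧ (R b a ↔ R b c))

end Conditions

end PermutreePosets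

namespace PermutreePosets

open Relation

/-! The proof replaces trees by their reachability relations on labels. The relations arising from
Schröder `δ`-permutrees are exactly the preorders of `IsPermutreePreorder`: a relation may be cut at
an intermediate label of `pos` or `neg`, and every incomparable pair satisfies (♠). Permutrees give
the antisymmetric ones. One direction is `IsLabeledTree.isPermutreePreorder`; for the other,
`isLabeledTree_hasseDigraph` shows that the Hasse diagram of the quotient is the required tree.

In these terms `T ≤ T'` says that increasing relations pass from `T'` to `T` and decreasing ones
from `T` to `T'` (`permutreeLE_iff`). Hence `≺_[T,T']` is just the intersection of the two tree
relations (`intervalRel_eq_interRel`). If `Q` is the preorder of `S`, the extremal permutrees of its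
face have the relations `minRel` and `maxRel`, obtained from `Q` by deleting the blocked pairs
(`combAdj_iff_cover`); the face poset is their intersection `faceInter`.

From faces to the conditions: a pair incomparable in `faceInter` is incomparable in `Q`, and then
(♠) is inherited; or related in one direction only, and then an end of the blocking pair witnesses
(♠); or equivalent in `Q`, and then any failure of (♣) is caused by a blocking pair that again
yields (♠).

Conversely, `S` is recovered from `[T,T']` by `hullRel`, in which the incomparable pairs without (♠)
(`Near`) become equivalent. The crux is `near_left`: near labels are interchangeable in the hull.
With `exists_near`, which locates a near pair across every relation of the hull missing from the
intersection, this makes the hull a permutree preorder, and `faceInter_hullRel` shows that its face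
poset is the original one. -/

/-- The intersection of two relations. -/
def interRel {α : Type} (T T' : α → α → Prop) (x y : α) : Prop := T x y ∧ T' x y

theorem interRel_comm {α : Type} (T T' : α → α → Prop) : interRel T T' = interRel T' T := by
  ext x y; exact and_comm

theorem interRel_op {α : Type} (T T' : α → α → Prop) :
    interRel (fun x y => T' y x) (fun x y => T y x) = fun x y => interRel T T' y x := by
  ext x y; exact and_comm

/-! ### Permutree preorders and intervals on a linearly ordered label set. -/

section Order

variable {α : Type} [LinearOrder α]

/-- `b` lies strictly between `x` and `y`. -/
def Btw (x b y : α) : Prop := (x < b ∧ b < y) ∨ (y < b ∧ b < x)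

theorem Btw.symm {x b y : α} (h : Btw x b y) : Btw y b x := Or.symm h

theorem btw_dual {x b y : α} : @Btw αᵒᵈ _ x b y ↔ Btw x b y := by
  constructor
  · rintro (⟨h, h'⟩ | ⟨h, h'⟩)
    · exact Or.inr ⟨h', h⟩
    · exact Or.inl ⟨h', h⟩
  · rintro (⟨h, h'⟩ | ⟨h, h'⟩)
    · exact Or.inr ⟨h', h⟩
    · exact Or.inl ⟨h', h⟩

theorem Btw.uIcc_left {x b y : α} (h : Btw x b y) : Set.uIcc x b ⊂ Set.uIcc x y := by
  refine Set.ssubset_iff_exists.2 ⟨fun z hz => ?_, y, ?_⟩ <;>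
    simp only [Set.mem_uIcc, Btw] at * <;> grind

theorem Btw.uIcc_right {x b y : α} (h : Btw x b y) : Set.uIcc b y ⊂ Set.uIcc x y := by
  refine Set.ssubset_iff_exists.2 ⟨fun z hz => ?_, x, ?_⟩ <;>
    simp only [Set.mem_uIcc, Btw] at * <;> grind

/-- The measure is the unordered interval spanned by the pair, so increasing and decreasing pairs
are treated at once. -/
theorem uIcc_induction [Finite α] {P : α → α → Prop}
    (h : ∀ x y, (∀ x' y', Set.uIcc x' y' ⊂ Set.uIcc x y → P x' y') → P x y) (x y : α) : P x y := by
  have wf : WellFounded (fun a b : α × α => Set.uIcc a.1 a.2 ⊂ Set.uIcc b.1 b.2) :=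
    InvImage.wf (fun a : α × α => Set.uIcc a.1 a.2) (wellFounded_lt (α := Set α))
  exact wf.induction (C := fun a => P a.1 a.2) (x, y) fun a ih => h _ _ fun x' y' hs => ih (x', y') hs

/-- The symmetric form of condition `(♠)`. -/
def SpadeBtw (pos neg : Set α) (R : α → α → Prop) (x y : α) : Prop :=
  ∃ b, Btw x b y ∧ ((b ∈ pos ∧ ¬ R x b ∧ ¬ R y b) ∨ (b ∈ neg ∧ ¬ R b x ∧ ¬ R b y))

theorem SpadeBtw.symm {pos neg : Set α} {R : α → α → Prop} {x y : α}
    (h : SpadeBtw pos neg R x y) : SpadeBtw pos neg R y x := by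
  obtain ⟨b, hb, h⟩ := h
  exact ⟨b, hb.symm, by tauto⟩

theorem SpadeBtw.mono {pos neg : Set α} {R R' : α → α → Prop} (hR : ∀ x y, R' x y → R x y) {x y : α}
    (h : SpadeBtw pos neg R x y) : SpadeBtw pos neg R' x y := by
  obtain ⟨b, hb, h⟩ := h
  exact ⟨b, hb, by have := hR x b; have := hR y b; have := hR b x; have := hR b y; tauto⟩

theorem spadeBtw_op {pos neg : Set α} {R : α → α → Prop} {x y : α} :
    SpadeBtw neg pos (fun i j => R j i) x y ↔ SpadeBtw pos neg R x y := by
  simp only [SpadeBtw, or_comm]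

theorem spadeBtw_dual {pos neg : Set α} {R : α → α → Prop} {x y : α} :
    @SpadeBtw αᵒᵈ _ pos neg R x y ↔ SpadeBtw pos neg R x y :=
  exists_congr fun _ => and_congr btw_dual Iff.rfl

/-- The symmetric form of condition `(♣)`. -/
def ClubBtw (R : α → α → Prop) (x y : α) : Prop :=
  ∀ b, Btw x b y → ((R x b ↔ R y b) ∧ (R b x ↔ R b y))

theorem ClubBtw.symm {R : α → α → Prop} {x y : α} (h : ClubBtw R x y) : ClubBtw R y x :=
  fun b hb => ⟨(h b hb.symm).1.symm, (h b hb.symm).2.symm⟩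

theorem clubBtw_op {R : α → α → Prop} {x y : α} :
    ClubBtw (fun i j => R j i) x y ↔ ClubBtw R x y :=
  forall_congr' fun _ => forall_congr' fun _ => and_comm

theorem clubBtw_dual {R : α → α → Prop} {x y : α} :
    @ClubBtw αᵒᵈ _ R x y ↔ ClubBtw R x y :=
  forall_congr' fun _ => imp_congr btw_dual Iff.rfl

/-- The preorders on labels that come from reachability in Schröder permutrees. -/
structure IsPermutreePreorder (pos neg : Set α) (Q : α → α → Prop) : Prop where
  refl : ∀ x, Q x x
  trans : ∀ {x y z}, Q x y → Q y z → Q x z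
  of_pos : ∀ {x b y}, Btw x b y → b ∈ pos → Q x y → Q x b
  of_neg : ∀ {x b y}, Btw x b y → b ∈ neg → Q x y → Q b y
  spade : ∀ {x y}, ¬ Q x y → ¬ Q y x → SpadeBtw pos neg Q x y

namespace IsPermutreePreorder

variable {pos neg : Set α} {Q : α → α → Prop}

/-- Two symmetries halve the work throughout: `op` reverses the relation and swaps `pos` with `neg`,
while `dual` reverses the order of the labels. On intervals each of them also swaps `T` and `T'`. -/
theorem op (h : IsPermutreePreorder pos neg Q) :
    IsPermutreePreorder neg pos (fun x y => Q y x) where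
  refl := h.refl
  trans h₁ h₂ := h.trans h₂ h₁
  of_pos hb hp hq := h.of_neg hb.symm hp hq
  of_neg hb hp hq := h.of_pos hb.symm hp hq
  spade h₁ h₂ := spadeBtw_op.2 (h.spade h₂ h₁)

theorem dual (h : IsPermutreePreorder pos neg Q) : @IsPermutreePreorder αᵒᵈ _ pos neg Q :=
  @IsPermutreePreorder.mk αᵒᵈ _ pos neg Q h.refl h.trans
    (fun hb => h.of_pos (btw_dual.1 hb)) (fun hb => h.of_neg (btw_dual.1 hb))
    (fun h₁ h₂ => spadeBtw_dual.2 (h.spade h₁ h₂))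

/-- If both fail, then `b` and `y` are incomparable, and a (♠) witness between them shortens the
relation from `x` to `y` to a contradiction. This is what later makes breaking ties by label order
transitive. -/
theorem left_or_right [Finite α] (h : IsPermutreePreorder pos neg Q) {x y b : α} (hb : Btw x b y)
    (hq : Q x y) : Q x b ∨ Q b y := by
  induction x, y using uIcc_induction with
  | h x y ih =>
    by_contra! hc
    obtain ⟨d, hd, ⟨hp, hd₁, hd₂⟩ | ⟨hn, hd₁, hd₂⟩⟩ :=
      h.spade hc.2 (fun hy => hc.1 (h.trans hq hy))
    · have hxd : Btw x d y := by grind [Btw]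
      rcases ih x d hxd.uIcc_left (by grind [Btw]) (h.of_pos hxd hp hq) with h' | h'
      · exact hc.1 h'
      · exact hd₁ h'
    · have hxd : Btw x d y := by grind [Btw]
      exact hd₂ (h.of_neg hxd hn hq)

end IsPermutreePreorder

/-- Increasing relations are antitone along the weak order on linear extensions. -/
theorem inc_of_linearExtensions [Finite α] {pos neg : Set α} {T T' L L' : α → α → Prop}
    (hT : IsPermutreePreorder pos neg T) (hT' : IsPermutreePreorder pos neg T')
    (hL : ∀ x y, T x y → L x y) (hL' : ∀ x y, T' x y → L' x y)
    (anti : ∀ x y, L x y → L y x → x = y) (le : ∀ x y, x < y → L' x y → L x y)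
    {x y : α} (hxy : x < y) (h : T' x y) : T x y := by
  induction x, y using uIcc_induction with
  | h x y ih =>
    by_contra hc
    obtain ⟨d, hd, ⟨hp, hd₁, hd₂⟩ | ⟨hn, hd₁, hd₂⟩⟩ := hT.spade hc
      (fun hy => hxy.ne (anti x y (le x y hxy (hL' _ _ h)) (hL _ _ hy)))
    · exact hd₁ (ih x d hd.uIcc_left (by grind [Btw]) (hT'.of_pos hd hp h))
    · exact hd₂ (ih d y hd.uIcc_right (by grind [Btw]) (hT'.of_neg hd hn h))

/-- A pair of comparable permutree posets. -/
structure IsPermutreeInterval (pos neg : Set α) (T T' : α → α → Prop) : Prop where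
  left : IsPermutreePreorder pos neg T
  right : IsPermutreePreorder pos neg T'
  anti_left : ∀ {x y}, T x y → T y x → x = y
  anti_right : ∀ {x y}, T' x y → T' y x → x = y
  inc : ∀ {x y}, x ≤ y → T' x y → T x y
  dec : ∀ {x y}, y ≤ x → T x y → T' x y

/-- The increasing relations of `T` together with the decreasing relations of `T'`. -/
def hullRel (T T' : α → α → Prop) (x y : α) : Prop := (x ≤ y ∧ T x y) ∨ (y ≤ x ∧ T' x y)

theorem hullRel_op (T T' : α → α → Prop) :
    hullRel (fun x y => T' y x) (fun x y => T y x) = fun x y => hullRel T T' y x := by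
  ext x y; exact or_comm

theorem hullRel_dual (T T' : α → α → Prop) : @hullRel αᵒᵈ _ T' T = hullRel T T' := by
  ext x y; exact or_comm

namespace IsPermutreeInterval

variable {pos neg : Set α} {T T' : α → α → Prop}

theorem op (h : IsPermutreeInterval pos neg T T') :
    IsPermutreeInterval neg pos (fun x y => T' y x) (fun x y => T y x) where
  left := h.right.op
  right := h.left.op
  anti_left h₁ h₂ := h.anti_right h₂ h₁
  anti_right h₁ h₂ := h.anti_left h₂ h₁
  inc h₁ h₂ := h.dec h₁ h₂
  dec h₁ h₂ := h.inc h₁ h₂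

theorem dual (h : IsPermutreeInterval pos neg T T') :
    @IsPermutreeInterval αᵒᵈ _ pos neg T' T :=
  @IsPermutreeInterval.mk αᵒᵈ _ pos neg T' T h.right.dual h.left.dual h.anti_right h.anti_left
    h.dec h.inc

theorem hullRel_of_interRel {x y : α} (h : interRel T T' x y) : hullRel T T' x y := by
  rcases le_total x y with h' | h'
  · exact Or.inl ⟨h', h.1⟩
  · exact Or.inr ⟨h', h.2⟩

theorem interRel_of_pos (h : IsPermutreeInterval pos neg T T') {x b y : α} (hb : Btw x b y)
    (hp : b ∈ pos) (hr : interRel T T' x y) : interRel T T' x b :=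
  ⟨h.left.of_pos hb hp hr.1, h.right.of_pos hb hp hr.2⟩

theorem interRel_of_neg (h : IsPermutreeInterval pos neg T T') {x b y : α} (hb : Btw x b y)
    (hp : b ∈ neg) (hr : interRel T T' x y) : interRel T T' b y :=
  ⟨h.left.of_neg hb hp hr.1, h.right.of_neg hb hp hr.2⟩

theorem hullRel_of_pos (h : IsPermutreeInterval pos neg T T') {x b y : α} (hb : Btw x b y)
    (hp : b ∈ pos) (hq : hullRel T T' x y) : hullRel T T' x b := by
  rcases hq with ⟨hxy, hq⟩ | ⟨hxy, hq⟩
  · exact Or.inl ⟨by grind [Btw], h.left.of_pos hb hp hq⟩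
  · exact Or.inr ⟨by grind [Btw], h.right.of_pos hb hp hq⟩

theorem hullRel_of_neg (h : IsPermutreeInterval pos neg T T') {x b y : α} (hb : Btw x b y)
    (hp : b ∈ neg) (hq : hullRel T T' x y) : hullRel T T' b y := by
  rcases hq with ⟨hxy, hq⟩ | ⟨hxy, hq⟩
  · exact Or.inl ⟨by grind [Btw], h.left.of_neg hb hp hq⟩
  · exact Or.inr ⟨by grind [Btw], h.right.of_neg hb hp hq⟩

theorem interRel_anti (h : IsPermutreeInterval pos neg T T') {x y : α} (h₁ : hullRel T T' x y)
    (h₂ : interRel T T' y x) : x = y := by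
  rcases h₁ with ⟨-, h₁⟩ | ⟨-, h₁⟩
  · exact h.anti_left h₁ h₂.1
  · exact h.anti_right h₁ h₂.2

/-- The composite lies in a single one of the two trees; if its direction is the wrong one for that
tree, `inc` or `dec` moves it to the other. -/
theorem interRel_trans_hullRel (h : IsPermutreeInterval pos neg T T') {x y z : α}
    (h₁ : interRel T T' x y) (h₂ : hullRel T T' y z) : hullRel T T' x z := by
  rcases h₂ with ⟨-, h₂⟩ | ⟨-, h₂⟩ <;> rcases le_total x z with hxz | hxz
  · exact Or.inl ⟨hxz, h.left.trans h₁.1 h₂⟩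
  · exact Or.inr ⟨hxz, h.dec hxz (h.left.trans h₁.1 h₂)⟩
  · exact Or.inl ⟨hxz, h.inc hxz (h.right.trans h₁.2 h₂)⟩
  · exact Or.inr ⟨hxz, h.right.trans h₁.2 h₂⟩

end IsPermutreeInterval

/-! ### The hull of an interval satisfying (♠) or (♣) is a permutree preorder. -/

/-- An interval whose relation satisfies: incomparable pairs satisfy `(♠)` or `(♣)`. -/
structure IsFaceInterval (pos neg : Set α) (T T' : α → α → Prop) : Prop extends
    IsPermutreeInterval pos neg T T' where
  spade_or_club : ∀ {x y}, ¬ interRel T T' x y → ¬ interRel T T' y x →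
    SpadeBtw pos neg (interRel T T') x y ∨ ClubBtw (interRel T T') x y

/-- Incomparable pairs that do not satisfy `(♠)`. -/
def Near (pos neg : Set α) (R : α → α → Prop) (x y : α) : Prop :=
  ¬ R x y ∧ ¬ R y x ∧ ¬ SpadeBtw pos neg R x y

theorem Near.symm {pos neg : Set α} {R : α → α → Prop} {x y : α} (h : Near pos neg R x y) :
    Near pos neg R y x := ⟨h.2.1, h.1, fun h' => h.2.2 h'.symm⟩

theorem near_op {pos neg : Set α} {R : α → α → Prop} {x y : α} :
    Near neg pos (fun i j => R j i) x y ↔ Near pos neg R x y := by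
  simp only [Near, spadeBtw_op]; tauto

theorem near_dual {pos neg : Set α} {R : α → α → Prop} {x y : α} :
    @Near αᵒᵈ _ pos neg R x y ↔ Near pos neg R x y :=
  and_congr Iff.rfl (and_congr Iff.rfl (not_congr spadeBtw_dual))

namespace IsFaceInterval

variable {pos neg : Set α} {T T' : α → α → Prop}

theorem op (h : IsFaceInterval pos neg T T') :
    IsFaceInterval neg pos (fun x y => T' y x) (fun x y => T y x) where
  toIsPermutreeInterval := h.toIsPermutreeInterval.op
  spade_or_club h₁ h₂ := by
    rw [interRel_op] at *
    rw [spadeBtw_op, clubBtw_op]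
    exact h.spade_or_club h₂ h₁

theorem dual (h : IsFaceInterval pos neg T T') : @IsFaceInterval αᵒᵈ _ pos neg T' T :=
  @IsFaceInterval.mk αᵒᵈ _ pos neg T' T h.toIsPermutreeInterval.dual (by
    rw [show @interRel αᵒᵈ T' T = interRel T T' from interRel_comm _ _]
    intro x y h₁ h₂
    exact (h.spade_or_club h₁ h₂).imp spadeBtw_dual.2 clubBtw_dual.2)

/-- An incomparable pair of `T` or of `T'` has a (♠) witness there, which remains one for the
smaller relation `interRel T T'`. -/
theorem near_lt (h : IsFaceInterval pos neg T T') {x y : α} (hxy : x < y)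
    (hn : Near pos neg (interRel T T') x y) : T x y ∧ T' y x := by
  obtain ⟨h₁, h₂, h₃⟩ := hn
  constructor
  · by_contra hc
    exact h₃ ((h.left.spade hc fun hc' => h₂ ⟨hc', h.dec hxy.le hc'⟩).mono fun _ _ => And.left)
  · by_contra hc
    exact h₃ ((h.right.spade (fun hc' => h₁ ⟨h.inc hxy.le hc', hc'⟩) hc).mono fun _ _ => And.right)

theorem near_club (h : IsFaceInterval pos neg T T') {x y : α}
    (hn : Near pos neg (interRel T T') x y) : ClubBtw (interRel T T') x y :=
  (h.spade_or_club hn.1 hn.2.1).resolve_left hn.2.2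

/-- By (♣), `x` and `y` are related to `b` in the same way, so a failure at `x` is also one at `y`
and `b` would witness (♠). -/
theorem near_pos (h : IsFaceInterval pos neg T T') {x y b : α}
    (hn : Near pos neg (interRel T T') x y) (hb : Btw x b y) (hp : b ∈ pos) :
    interRel T T' x b := by
  by_contra hc
  exact hn.2.2 ⟨b, hb, Or.inl ⟨hp, hc, fun h' => hc ((h.near_club hn b hb).1.2 h')⟩⟩

theorem near_neg (h : IsFaceInterval pos neg T T') {x y b : α}
    (hn : Near pos neg (interRel T T') x y) (hb : Btw x b y) (hp : b ∈ neg) :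
    interRel T T' b x := by
  by_contra hc
  exact hn.2.2 ⟨b, hb, Or.inr ⟨hp, hc, fun h' => hc ((h.near_club hn b hb).2.2 h')⟩⟩

theorem near_of_btw (h : IsFaceInterval pos neg T T') {x y b : α}
    (hn : Near pos neg (interRel T T') x y) (hb : Btw x b y)
    (h₁ : ¬ interRel T T' x b) (h₂ : ¬ interRel T T' b x) : Near pos neg (interRel T T') x b := by
  refine ⟨h₁, h₂, ?_⟩
  rintro ⟨d, hd, ⟨hp, hd₁, -⟩ | ⟨hp, hd₁, -⟩⟩
  · exact hd₁ (h.near_pos hn (by grind [Btw]) hp)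
  · exact hd₁ (h.near_neg hn (by grind [Btw]) hp)

/-- If `y` and `z` are incomparable in `T`, a (♠) witness gives a smaller instance or a direct
contradiction. If instead `T z y`, then `z` precedes `y` in the intersection as well, and the
hypothesis on the pair `x < z` has to be used. -/
theorem near_left [Finite α] (h : IsFaceInterval pos neg T T') {x y z : α} (hxy : x < y)
    (hyz : y < z) (hn : Near pos neg (interRel T T') x y) (hxz : T x z) : T y z := by
  induction x, z using uIcc_induction with
  | h x z ih =>
    by_contra hc
    have hxyz : Btw x y z := Or.inl ⟨hxy, hyz⟩
    by_cases hzy : T z y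
    · have hR : interRel T T' z y := ⟨hzy, h.dec hyz.le hzy⟩
      -- The least such label `f` satisfies `T x f`, since a witness against this would be a smaller
      -- such label or contradict nearness. The smaller instance `x, f` then gives `T y f`, while
      -- cutting `T z y` at `f` gives `T f y`.
      have key : ∀ d, y < d → d < z → d ∈ neg → ¬ T d x → False := by
        intro d h₁ h₂ h₃ h₄
        obtain ⟨f, ⟨⟨hf₁, hf₂, hf₃, hf₄⟩, hf⟩⟩ :=
          (Set.toFinite {f | y < f ∧ f < z ∧ f ∈ neg ∧ ¬ T f x}).exists_minimal ⟨d, h₁, h₂, h₃, h₄⟩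
        have hxf : T x f := by
          by_contra hxf
          obtain ⟨g, hg, ⟨hp, hg₁, -⟩ | ⟨hp, hg₁, -⟩⟩ := h.left.spade hxf hf₄
          · exact hg₁ (h.left.of_pos (by grind [Btw]) hp hxz)
          · rcases lt_trichotomy g y with hgy | rfl | hgy
            · exact hg₁ (h.near_neg hn (by grind [Btw]) hp).1
            · exact hc (h.left.of_neg hxyz hp hxz)
            · have hgf : g < f := by grind [Btw]
              exact absurd (hf ⟨hgy, hgf.trans hf₂, hp, hg₁⟩ hgf.le) (not_le.2 hgf)
        have hfy : T f y := (h.interRel_of_neg (Or.inr ⟨hf₁, hf₂⟩) hf₃ hR).1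
        have hyf := ih x f (Btw.uIcc_left (Or.inl ⟨hxy.trans hf₁, hf₂⟩)) hxy hf₁ hn hxf
        exact hf₁.ne (h.anti_left hyf hfy)
      rcases h.spade_or_club (x := x) (y := z)
        (fun hr => hn.1 ⟨h.left.trans hr.1 hR.1, h.right.trans hr.2 hR.2⟩)
        (fun hr => (hxy.trans hyz).ne (h.anti_left hxz hr.1)) with hs | hs
      · obtain ⟨d, hd, ⟨hp, hd₁, hd₂⟩ | ⟨hp, hd₁, hd₂⟩⟩ := hs
        · rcases lt_trichotomy d y with hdy | rfl | hdy
          · exact hd₁ (h.near_pos hn (by grind [Btw]) hp)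
          · exact hd₂ hR
          · exact hd₂ (h.interRel_of_pos (by grind [Btw]) hp hR)
        · rcases lt_trichotomy d y with hdy | rfl | hdy
          · exact hd₁ (h.near_neg hn (by grind [Btw]) hp)
          · exact hc (h.left.of_neg hxyz hp hxz)
          · exact key d hdy (by grind [Btw]) hp fun hdx =>
              hd₁ ⟨hdx, h.dec (hxy.trans hdy).le hdx⟩
      · exact hn.1 ((hs y hxyz).1.2 hR)
    · obtain ⟨d, hd, ⟨hp, hd₁, hd₂⟩ | ⟨hp, hd₁, hd₂⟩⟩ := h.left.spade hc hzy
      · have hxd : Btw x d z := by grind [Btw]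
        exact hd₁ (ih x d hxd.uIcc_left hxy (by grind [Btw]) hn (h.left.of_pos hxd hp hxz))
      · exact hd₂ (h.left.of_neg (by grind [Btw]) hp hxz)

/-- Below `x` this is transitivity in `T'`, and above `y` it is `near_left`. Between them, either
(♣) transfers the relation or `z` and `y` are themselves near. -/
theorem hullRel_of_near_of_lt [Finite α] (h : IsFaceInterval pos neg T T') {x y z : α}
    (hxy : x < y) (hn : Near pos neg (interRel T T') x y) (hq : hullRel T T' x z) :
    hullRel T T' y z := by
  obtain ⟨hT, hT'⟩ := h.near_lt hxy hn
  rcases lt_trichotomy z x with hz | rfl | hz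
  · have : T' x z := hq.elim (fun h' => absurd h'.1 (not_le.2 hz)) And.right
    exact Or.inr ⟨(hz.trans hxy).le, h.right.trans hT' this⟩
  · exact Or.inr ⟨hxy.le, hT'⟩
  have hxz : T x z := hq.elim And.right fun h' => absurd h'.1 (not_le.2 hz)
  rcases lt_trichotomy z y with hzy | rfl | hzy
  · have hb : Btw x z y := Or.inl ⟨hz, hzy⟩
    by_cases h₁ : interRel T T' x z
    · exact IsPermutreeInterval.hullRel_of_interRel ((h.near_club hn z hb).1.1 h₁)
    have h₂ : ¬ interRel T T' z x := fun h₂ => hz.ne (h.anti_left hxz h₂.1)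
    exact Or.inr ⟨hzy.le, (h.near_lt hzy (h.near_of_btw hn.symm hb.symm
      (fun h' => h₁ ((h.near_club hn z hb).1.2 h'))
      (fun h' => h₂ ((h.near_club hn z hb).2.2 h'))).symm).2⟩
  · exact Or.inl ⟨le_rfl, h.left.refl _⟩
  · exact Or.inl ⟨hzy.le, h.near_left hxy hzy hn hxz⟩

theorem hullRel_of_near [Finite α] (h : IsFaceInterval pos neg T T') {x y z : α}
    (hn : Near pos neg (interRel T T') x y) (hq : hullRel T T' x z) : hullRel T T' y z := by
  rcases lt_trichotomy x y with hxy | rfl | hxy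
  · exact h.hullRel_of_near_of_lt hxy hn hq
  · exact hq
  · rw [← hullRel_dual]
    refine @hullRel_of_near_of_lt αᵒᵈ _ pos neg T' T _ h.dual x y z hxy ?_ ?_
    · exact near_dual.2 (interRel_comm T T' ▸ hn)
    · rw [hullRel_dual]
      exact hq

theorem hullRel_of_near_right [Finite α] (h : IsFaceInterval pos neg T T') {x y z : α}
    (hn : Near pos neg (interRel T T') x y) (hq : hullRel T T' z x) : hullRel T T' z y := by
  have := h.op.hullRel_of_near (x := x) (y := y) (z := z)
  rw [interRel_op, hullRel_op, near_op] at this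
  exact this hn hq

theorem hullRel_self (h : IsFaceInterval pos neg T T') (x : α) : hullRel T T' x x :=
  Or.inl ⟨le_rfl, h.left.refl x⟩

theorem near_hullRel [Finite α] (h : IsFaceInterval pos neg T T') {x y : α}
    (hn : Near pos neg (interRel T T') x y) : hullRel T T' x y :=
  h.hullRel_of_near_right hn (h.hullRel_self x)

/-- A relation of the hull that is not in the intersection crosses an incomparable pair. -/
theorem exists_near [Finite α] (h : IsFaceInterval pos neg T T') {x y : α}
    (hq : hullRel T T' x y) (hr : ¬ interRel T T' x y) :
    ∃ e e', Near pos neg (interRel T T') e e' ∧ (e = x ∨ e ∈ neg ∧ Btw x e y) ∧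
      (e' = y ∨ e' ∈ pos ∧ Btw x e' y) ∧ (x < y → e < e') ∧ (y < x → e' < e) := by
  induction x, y using uIcc_induction with
  | h x y ih =>
    have hr' : ¬ interRel T T' y x := fun hr' => by
      have := h.interRel_anti hq hr'
      subst this
      exact hr hr'
    by_cases hs : SpadeBtw pos neg (interRel T T') x y
    · obtain ⟨d, hd, ⟨hp, hd₁, -⟩ | ⟨hp, -, hd₁⟩⟩ := hs
      · obtain ⟨e, e', h₁, h₂, h₃, h₄, h₅⟩ :=
          ih x d hd.uIcc_left (h.hullRel_of_pos hd hp hq) hd₁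
        exact ⟨e, e', h₁, by grind [Btw], by grind [Btw], by grind [Btw], by grind [Btw]⟩
      · obtain ⟨e, e', h₁, h₂, h₃, h₄, h₅⟩ :=
          ih d y hd.uIcc_right (h.hullRel_of_neg hd hp hq) hd₁
        exact ⟨e, e', h₁, by grind [Btw], by grind [Btw], by grind [Btw], by grind [Btw]⟩
    · exact ⟨x, y, ⟨hr, hr', hs⟩, Or.inl rfl, Or.inl rfl, id, id⟩

/-- Relations of the intersection compose directly. Any other first factor crosses a near pair,
whose ends can be exchanged, leaving shorter first factors. -/
theorem hullRel_trans [Finite α] (h : IsFaceInterval pos neg T T') {x y z : α}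
    (h₁ : hullRel T T' x y) (h₂ : hullRel T T' y z) : hullRel T T' x z := by
  induction x, y using uIcc_induction generalizing z with
  | h x y ih =>
    by_cases hr : interRel T T' x y
    · exact h.interRel_trans_hullRel hr h₂
    obtain ⟨e, e', hn, rfl | ⟨he, hb⟩, he', -⟩ := h.exists_near h₁ hr
    · rcases he' with rfl | ⟨he', hb'⟩
      · exact h.hullRel_of_near hn.symm h₂
      · exact h.hullRel_of_near hn.symm (ih e' y hb'.uIcc_right (h.hullRel_of_near hn h₁) h₂)
    · have hez := ih e y hb.uIcc_right (h.hullRel_of_neg hb he h₁) h₂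
      rcases he' with rfl | ⟨he', hb'⟩
      · exact ih x e hb.uIcc_left (h.hullRel_of_near_right hn.symm h₁) hez
      · exact ih x e' hb'.uIcc_left (h.hullRel_of_pos hb' he' h₁) (h.hullRel_of_near hn hez)

/-- Repairs a (♠) witness `d` of the intersection that is lost because the hull relates `x` to `d`.
-/
theorem spadeBtw_hullRel_aux [Finite α] (h : IsFaceInterval pos neg T T') {x y d : α}
    (ih : ∀ x' y', Set.uIcc x' y' ⊂ Set.uIcc x y → ¬ hullRel T T' x' y' → ¬ hullRel T T' y' x' →
      SpadeBtw pos neg (hullRel T T') x' y')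
    (h₁ : ¬ hullRel T T' x y) (h₂ : ¬ hullRel T T' y x) (hd : Btw x d y) (hp : d ∈ pos)
    (hq : hullRel T T' x d) (hr : ¬ interRel T T' x d) : SpadeBtw pos neg (hullRel T T') x y := by
  -- If `e` is equivalent to `x`, a witness for the shorter pair `e, y` also serves `x, y`.
  have key : ∀ e, Btw x e y → hullRel T T' x e → hullRel T T' e x →
      SpadeBtw pos neg (hullRel T T') x y := by
    intro e hb h₃ h₄
    obtain ⟨b, hb', hs⟩ := ih e y hb.uIcc_right (fun h' => h₁ (h.hullRel_trans h₃ h'))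
      (fun h' => h₂ (h.hullRel_trans h' h₄))
    refine ⟨b, by grind [Btw], hs.imp (fun hs => ⟨hs.1, fun h' => hs.2.1 ?_, hs.2.2⟩)
      (fun hs => ⟨hs.1, fun h' => hs.2.1 ?_, hs.2.2⟩)⟩
    · exact h.hullRel_trans h₄ h'
    · exact h.hullRel_trans h' h₃
  obtain ⟨e, e', hn, he, he', -⟩ := h.exists_near hq hr
  obtain ⟨hp', hb'⟩ : e' ∈ pos ∧ Btw x e' y := by grind [Btw]
  rcases he with rfl | ⟨he, hb⟩
  · exact key e' hb' (h.near_hullRel hn) (h.near_hullRel hn.symm)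
  · have hb : Btw x e y := by grind [Btw]
    have hxe : hullRel T T' x e := by
      refine h.hullRel_of_near_right hn.symm ?_
      rcases he' with rfl | ⟨-, hb''⟩
      · exact hq
      · exact h.hullRel_of_pos hb'' hp' hq
    by_cases hex : hullRel T T' e x
    · exact key e hb hxe hex
    · exact ⟨e, hb, Or.inr ⟨he, hex, fun h' => h₁ (h.hullRel_trans hxe h')⟩⟩

theorem spadeBtw_hullRel [Finite α] (h : IsFaceInterval pos neg T T') {x y : α}
    (h₁ : ¬ hullRel T T' x y) (h₂ : ¬ hullRel T T' y x) : SpadeBtw pos neg (hullRel T T') x y := by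
  induction x, y using uIcc_induction with
  | h x y ih =>
    have ih' : ∀ x' y', Set.uIcc x' y' ⊂ Set.uIcc y x → ¬ hullRel T T' x' y' →
        ¬ hullRel T T' y' x' → SpadeBtw pos neg (hullRel T T') x' y' := by
      rw [Set.uIcc_comm]; exact ih
    have hs : SpadeBtw pos neg (interRel T T') x y := by
      by_contra hs
      exact h₁ (h.near_hullRel ⟨fun h' => h₁ (IsPermutreeInterval.hullRel_of_interRel h'),
        fun h' => h₂ (IsPermutreeInterval.hullRel_of_interRel h'), hs⟩)
    obtain ⟨d, hd, ⟨hp, hd₁, hd₂⟩ | ⟨hp, hd₁, hd₂⟩⟩ := hs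
    · by_cases hx : hullRel T T' x d
      · exact h.spadeBtw_hullRel_aux ih h₁ h₂ hd hp hx hd₁
      by_cases hy : hullRel T T' y d
      · exact (h.spadeBtw_hullRel_aux ih' h₂ h₁ hd.symm hp hy hd₂).symm
      exact ⟨d, hd, Or.inl ⟨hp, hx, hy⟩⟩
    · have key := fun x y => h.op.spadeBtw_hullRel_aux (x := x) (y := y) (d := d)
      rw [hullRel_op, interRel_op] at key
      simp only [spadeBtw_op] at key
      by_cases hx : hullRel T T' d x
      · exact key x y (fun x' y' h' h₃ h₄ => ih x' y' h' h₄ h₃) h₂ h₁ hd hp hx hd₁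
      by_cases hy : hullRel T T' d y
      · exact (key y x (fun x' y' h' h₃ h₄ => ih' x' y' h' h₄ h₃) h₁ h₂ hd.symm hp hy hd₂).symm
      exact ⟨d, hd, Or.inr ⟨hp, hx, hy⟩⟩

theorem isPermutreePreorder_hullRel [Finite α] (h : IsFaceInterval pos neg T T') :
    IsPermutreePreorder pos neg (hullRel T T') where
  refl := h.hullRel_self
  trans := h.hullRel_trans
  of_pos := h.hullRel_of_pos
  of_neg := h.hullRel_of_neg
  spade := h.spadeBtw_hullRel

end IsFaceInterval

end Order

/-! ### Posets of the extremal permutrees of a face. -/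

section Combs

variable {α : Type} [LinearOrder α]

/-- The pair `y < x` is blocked: every path from `x` to `y` has to go down through some class of
`Q` that is replaced by an increasing chain. -/
def Blocked (pos neg : Set α) (Q : α → α → Prop) (x y : α) : Prop :=
  ∃ b b', y ≤ b ∧ b < b' ∧ b' ≤ x ∧ Q b b' ∧ Q b' b ∧ (b ∈ pos ∨ b = y) ∧ (b' ∈ neg ∨ b' = x)

/-- The partial order obtained from a permutree preorder by replacing each class by an increasing
chain. -/
def minRel (pos neg : Set α) (Q : α → α → Prop) (x y : α) : Prop :=
  Q x y ∧ ¬ Blocked pos neg Q x y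

/-- The partial order obtained from a permutree preorder by replacing each class by a decreasing
chain. -/
def maxRel (pos neg : Set α) (Q : α → α → Prop) : α → α → Prop :=
  @minRel αᵒᵈ _ pos neg Q

theorem Blocked.lt {pos neg : Set α} {Q : α → α → Prop} {x y : α} (h : Blocked pos neg Q x y) :
    y < x := by
  obtain ⟨b, b', h₁, h₂, h₃, -⟩ := h
  exact h₁.trans_lt (h₂.trans_le h₃)

theorem minRel_of_le {pos neg : Set α} {Q : α → α → Prop} {x y : α} (hxy : x ≤ y) (h : Q x y) :
    minRel pos neg Q x y := ⟨h, fun h' => h'.lt.not_ge hxy⟩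

theorem maxRel_of_le {pos neg : Set α} {Q : α → α → Prop} {x y : α} (hxy : y ≤ x) (h : Q x y) :
    maxRel pos neg Q x y := @minRel_of_le αᵒᵈ _ pos neg Q x y hxy h

theorem minRel_op {pos neg : Set α} {Q : α → α → Prop} {x y : α} :
    minRel neg pos (fun i j => Q j i) x y ↔ maxRel pos neg Q y x := by
  refine and_congr Iff.rfl (not_congr ?_)
  constructor
  · rintro ⟨b, b', h₁, h₂, h₃, h₄, h₅, h₆, h₇⟩
    exact ⟨b', b, h₃, h₂, h₁, h₄, h₅, h₇, h₆⟩
  · rintro ⟨b, b', h₁, h₂, h₃, h₄, h₅, h₆, h₇⟩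
    exact ⟨b', b, h₃, h₂, h₁, h₄, h₅, h₇, h₆⟩

theorem maxRel_op {pos neg : Set α} {Q : α → α → Prop} {x y : α} :
    maxRel neg pos (fun i j => Q j i) x y ↔ minRel pos neg Q y x :=
  (minRel_op (pos := neg) (neg := pos) (Q := fun i j => Q j i)).symm

namespace IsPermutreePreorder

variable {pos neg : Set α} {Q : α → α → Prop}

theorem blocked_left (h : IsPermutreePreorder pos neg Q) {x y b b' : α} (hxy : Q x y) (h₁ : y ≤ b)
    (h₂ : b < b') (h₃ : b' ≤ x) (hb : b ∈ pos ∨ b = y) : Q x b := by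
  rcases hb with hb | rfl
  · rcases h₁.eq_or_lt with rfl | h₁
    · exact hxy
    · exact h.of_pos (Or.inr ⟨h₁, h₂.trans_le h₃⟩) hb hxy
  · exact hxy

theorem blocked_right (h : IsPermutreePreorder pos neg Q) {x y b b' : α} (hxy : Q x y)
    (h₁ : y ≤ b) (h₂ : b < b') (h₃ : b' ≤ x) (hb : b' ∈ neg ∨ b' = x) : Q b' y := by
  rcases hb with hb | rfl
  · rcases h₃.eq_or_lt with rfl | h₃
    · exact hxy
    · exact h.of_neg (Or.inr ⟨h₁.trans_lt h₂, h₃⟩) hb hxy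
  · exact hxy

/-- A block `b < b'` of `x, z` outside `b < y < b'` blocks one of the two factors, unless an end is
admissible only as `x` or `z`. In that case, as when `y` lies strictly inside, `y` belongs to the
class of the block and can replace one of its ends. -/
theorem minRel_trans (h : IsPermutreePreorder pos neg Q) {x y z : α} (hxy : minRel pos neg Q x y)
    (hyz : minRel pos neg Q y z) : minRel pos neg Q x z := by
  have hxz := h.trans hxy.1 hyz.1
  refine ⟨hxz, fun ⟨b, b', h₁, h₂, h₃, h₄, h₅, h₆, h₇⟩ => ?_⟩
  have hxb := h.blocked_left hxz h₁ h₂ h₃ h₆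
  have hbz := h.blocked_right hxz h₁ h₂ h₃ h₇
  rcases le_or_gt b' y with hy | hy
  · refine hyz.2 ⟨b, b', h₁, h₂, hy, h₄, h₅, h₆, ?_⟩
    rcases h₇ with h₇ | rfl
    · exact Or.inl h₇
    · rcases hy.eq_or_lt with rfl | hy
      · exact Or.inr rfl
      rcases h₆ with h₆ | rfl
      · have hyb : Q y b := by
          rcases h₁.eq_or_lt with rfl | h₁
          · exact hyz.1
          · exact h.of_pos (Or.inr ⟨h₁, h₂.trans hy⟩) h₆ hyz.1
        exact absurd ⟨b, y, h₁, h₂.trans hy, le_rfl, h.trans h₄ hxy.1, hyb, Or.inl h₆, Or.inr rfl⟩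
          hyz.2
      · exact absurd ⟨b, y, le_rfl, h₂.trans hy, le_rfl, h.trans h₄ hxy.1, hyz.1, Or.inr rfl,
          Or.inr rfl⟩ hyz.2
  rcases le_or_gt y b with hy' | hy'
  · refine hxy.2 ⟨b, b', hy', h₂, h₃, h₄, h₅, ?_, h₇⟩
    rcases h₆ with h₆ | rfl
    · exact Or.inl h₆
    · rcases hy'.eq_or_lt with rfl | hy'
      · exact Or.inr rfl
      have hby : Q b' y := h.blocked_right hxy.1 hy'.le h₂ h₃ h₇
      exact absurd ⟨y, b', le_rfl, hy'.trans h₂, h₃, h.trans hyz.1 h₄, hby, Or.inr rfl, h₇⟩ hxy.2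
  · have hyb : Q y b := h.blocked_left hyz.1 h₁ hy' le_rfl h₆
    have hby : Q b' y := h.blocked_right hxy.1 le_rfl hy h₃ h₇
    exact hyz.2 ⟨b, y, h₁, hy', le_rfl, h.trans h₄ hby, hyb, h₆, Or.inr rfl⟩

theorem minRel_anti {x y : α} (hxy : minRel pos neg Q x y) (hyx : minRel pos neg Q y x) :
    x = y := by
  by_contra hne
  rcases lt_or_gt_of_ne hne with h' | h'
  · exact hyx.2 ⟨x, y, le_rfl, h', le_rfl, hxy.1, hyx.1, Or.inr rfl, Or.inr rfl⟩
  · exact hxy.2 ⟨y, x, le_rfl, h', le_rfl, hyx.1, hxy.1, Or.inr rfl, Or.inr rfl⟩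

theorem not_minRel {x y : α} (hyx : y < x) (h' : Q y x) : ¬ minRel pos neg Q x y :=
  fun h₁ => hyx.ne (minRel_anti (minRel_of_le hyx.le h') h₁)

/-- The witness is `b'` if `y` belongs to the class of the block, and `b` otherwise. Leaving `R`
free lets this serve both `minRel` and the face relation. -/
theorem blocked_spade (h : IsPermutreePreorder pos neg Q) {x y : α} {R : α → α → Prop}
    (hR : ∀ i j, R i j → minRel pos neg Q i j) (hxy : Q x y) (hyx : ¬ Q y x)
    (hb : Blocked pos neg Q x y) : SpadeBtw pos neg R x y := by
  obtain ⟨b, b', h₁, h₂, h₃, h₄, h₅, h₆, h₇⟩ := hb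
  have hxb := h.blocked_left hxy h₁ h₂ h₃ h₆
  have hby := h.blocked_right hxy h₁ h₂ h₃ h₇
  by_cases hyb : Q y b
  · have hx : b' ≠ x := fun e => hyx (e ▸ h.trans hyb h₄)
    exact ⟨b', Or.inr ⟨h₁.trans_lt h₂, lt_of_le_of_ne h₃ hx⟩, Or.inr ⟨h₇.resolve_right hx,
      fun h' => hyx (h.trans hyb (h.trans h₄ (hR _ _ h').1)),
      fun h' => not_minRel (h₁.trans_lt h₂) (h.trans hyb h₄) (hR _ _ h')⟩⟩
  · have hy : b ≠ y := fun e => hyb (e ▸ h.refl b)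
    exact ⟨b, Or.inr ⟨lt_of_le_of_ne h₁ hy.symm, h₂.trans_le h₃⟩, Or.inl ⟨h₆.resolve_right hy,
      fun h' => (hR _ _ h').2 ⟨b, b', le_rfl, h₂, h₃, h₄, h₅, Or.inr rfl, h₇⟩,
      fun h' => hyb (hR _ _ h').1⟩⟩

theorem isPermutreePreorder_minRel (h : IsPermutreePreorder pos neg Q) :
    IsPermutreePreorder pos neg (minRel pos neg Q) where
  refl x := minRel_of_le le_rfl (h.refl x)
  trans := h.minRel_trans
  of_pos {x b y} hb hp hq := by
    refine ⟨h.of_pos hb hp hq.1, fun ⟨d, d', h₁, h₂, h₃, h₄, h₅, h₆, h₇⟩ =>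
      hq.2 ⟨d, d', ?_, h₂, h₃, h₄, h₅, ?_, h₇⟩⟩
    · grind [Btw]
    · grind
  of_neg {x b y} hb hp hq := by
    refine ⟨h.of_neg hb hp hq.1, fun ⟨d, d', h₁, h₂, h₃, h₄, h₅, h₆, h₇⟩ =>
      hq.2 ⟨d, d', h₁, h₂, ?_, h₄, h₅, h₆, ?_⟩⟩
    · grind [Btw]
    · grind
  spade {x y} h₁ h₂ := by
    have key : ∀ {x y}, ¬ minRel pos neg Q x y → ¬ minRel pos neg Q y x → Q x y →
        SpadeBtw pos neg (minRel pos neg Q) x y := by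
      intro x y h₁ h₂ hxy
      have hb : Blocked pos neg Q x y := by
        by_contra hb
        exact h₁ ⟨hxy, hb⟩
      exact h.blocked_spade (fun _ _ => id) hxy (fun hyx => h₂ (minRel_of_le hb.lt.le hyx)) hb
    by_cases hxy : Q x y
    · exact key h₁ h₂ hxy
    by_cases hyx : Q y x
    · exact (key h₂ h₁ hyx).symm
    exact (h.spade hxy hyx).mono fun _ _ => And.left

theorem isPermutreeInterval (h : IsPermutreePreorder pos neg Q) :
    IsPermutreeInterval pos neg (minRel pos neg Q) (maxRel pos neg Q) where
  left := h.isPermutreePreorder_minRel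
  right := h.dual.isPermutreePreorder_minRel.dual
  anti_left := minRel_anti
  anti_right := fun h₁ h₂ => @minRel_anti αᵒᵈ _ pos neg Q _ _ h₁ h₂
  inc hxy h' := minRel_of_le hxy h'.1
  dec hxy h' := maxRel_of_le hxy h'.1

/-- The relation of a face. -/
def faceInter (pos neg : Set α) (Q : α → α → Prop) : α → α → Prop :=
  interRel (minRel pos neg Q) (maxRel pos neg Q)

theorem faceInter_dual : @faceInter αᵒᵈ _ pos neg Q = faceInter pos neg Q :=
  interRel_comm _ _

theorem faceInter_op : faceInter neg pos (fun i j => Q j i) = fun i j => faceInter pos neg Q j i := by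
  ext x y
  exact (and_congr minRel_op maxRel_op).trans and_comm

/-- Each class is ordered in opposite ways by the two combs, so it becomes an antichain in their
intersection. -/
theorem faceInter_eq {x y : α} (h : faceInter pos neg Q x y) (h' : Q y x) : x = y := by
  rcases le_total x y with hxy | hxy
  · exact @minRel_anti αᵒᵈ _ pos neg Q x y h.2 (maxRel_of_le hxy h')
  · exact minRel_anti h.1 (minRel_of_le hxy h')

/-- The lower end `d` of a block for `y, b` is equivalent to `x` and `y`. Either `d = b`, which puts
`b` in that class, or `d ∈ pos` lies between `x` and `y` and witnesses (♠), because a class is an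
antichain. -/
theorem faceInter_club_of_lt (h : IsPermutreePreorder pos neg Q) {x y b : α} (hxy : Q x y)
    (hyx : Q y x) (hs : ¬ SpadeBtw pos neg (faceInter pos neg Q) x y) (hb : Btw x b y)
    (hxb : faceInter pos neg Q x b) : minRel pos neg Q y b := by
  refine ⟨h.trans hyx hxb.1.1, fun ⟨d, d', h₁, h₂, h₃, h₄, h₅, h₆, h₇⟩ => ?_⟩
  have hyb := h.trans hyx hxb.1.1
  have hne : x ≠ b := by grind [Btw]
  have hbd : Q y d := h.blocked_left hyb h₁ h₂ h₃ h₆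
  have hdy : Q d' y := by
    rcases h₇ with h₇ | rfl
    · rcases h₃.eq_or_lt with rfl | h₃
      · exact h.refl _
      · exact h.of_neg (by grind [Btw]) h₇ hxy
    · exact h.refl _
  rcases h₁.eq_or_lt with rfl | h₁
  · exact hne (faceInter_eq hxb (h.trans (h.trans h₄ hdy) hyx))
  · have hp : d ∈ pos := h₆.resolve_right h₁.ne'
    refine hs ⟨d, by grind [Btw], Or.inl ⟨hp, fun h' => ?_, fun h' => ?_⟩⟩
    · have := faceInter_eq h' (h.trans h₄ (h.trans hdy hyx))
      grind [Btw]
    · have := faceInter_eq h' (h.trans h₄ hdy)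
      grind [Btw]

theorem faceInter_club (h : IsPermutreePreorder pos neg Q) {x y b : α} (hxy : Q x y)
    (hyx : Q y x) (hs : ¬ SpadeBtw pos neg (faceInter pos neg Q) x y) (hb : Btw x b y)
    (hxb : faceInter pos neg Q x b) : faceInter pos neg Q y b := by
  refine ⟨h.faceInter_club_of_lt hxy hyx hs hb hxb, ?_⟩
  refine h.dual.faceInter_club_of_lt hxy hyx (fun h' => hs ?_) (btw_dual.2 hb) ?_
  · rw [faceInter_dual] at h'
    exact spadeBtw_dual.1 h'
  · rw [faceInter_dual]
    exact hxb

theorem faceInter_spade (h : IsPermutreePreorder pos neg Q) {x y : α} (hxy : Q x y) (hyx : ¬ Q y x)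
    (hf : ¬ faceInter pos neg Q x y) : SpadeBtw pos neg (faceInter pos neg Q) x y := by
  by_cases hb : Blocked pos neg Q x y
  · exact h.blocked_spade (fun _ _ => And.left) hxy hyx hb
  · have hb' : @Blocked αᵒᵈ _ pos neg Q x y := by
      by_contra hb'
      exact hf ⟨⟨hxy, hb⟩, ⟨hxy, hb'⟩⟩
    exact spadeBtw_dual.1 (h.dual.blocked_spade (fun _ _ => And.right) hxy hyx hb')

theorem faceInter_spade_or_club (h : IsPermutreePreorder pos neg Q) {x y : α}
    (h₁ : ¬ faceInter pos neg Q x y) (h₂ : ¬ faceInter pos neg Q y x) :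
    SpadeBtw pos neg (faceInter pos neg Q) x y ∨ ClubBtw (faceInter pos neg Q) x y := by
  by_cases hxy : Q x y <;> by_cases hyx : Q y x
  · refine or_iff_not_imp_left.2 fun hs b hb => ?_
    have hs' : ¬ SpadeBtw pos neg (faceInter pos neg Q) y x := fun h' => hs h'.symm
    refine ⟨⟨h.faceInter_club hxy hyx hs hb, h.faceInter_club hyx hxy hs' hb.symm⟩, ?_⟩
    have key := fun x y => h.op.faceInter_club (x := x) (y := y) (b := b)
    rw [faceInter_op] at key
    simp only [spadeBtw_op] at key
    exact ⟨key x y hyx hxy hs hb, key y x hxy hyx hs' hb.symm⟩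
  · exact Or.inl (h.faceInter_spade hxy hyx h₁)
  · exact Or.inl (h.faceInter_spade hyx hxy h₂).symm
  · exact Or.inl ((h.spade hxy hyx).mono fun _ _ h' => h'.1.1)

end IsPermutreePreorder

open IsPermutreePreorder

namespace IsFaceInterval

variable {pos neg : Set α} {T T' : α → α → Prop}

/-- Cutting the relation at both ends of the block gives a relation of the intersection from `b'` to
`b`, against the hull relation from `b` to `b'`. -/
theorem not_blocked_of_interRel (h : IsFaceInterval pos neg T T') {x y : α}
    (hr : interRel T T' x y) : ¬ Blocked pos neg (hullRel T T') x y := by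
  rintro ⟨b, b', h₁, h₂, h₃, h₄, h₅, h₆, h₇⟩
  have hxb : interRel T T' x b := by
    rcases h₆ with h₆ | rfl
    · rcases h₁.eq_or_lt with rfl | h₁
      · exact hr
      · exact h.interRel_of_pos (by grind [Btw]) h₆ hr
    · exact hr
  have hbb : interRel T T' b' b := by
    rcases h₇ with h₇ | rfl
    · rcases h₃.eq_or_lt with rfl | h₃
      · exact hxb
      · exact h.interRel_of_neg (by grind [Btw]) h₇ hxb
    · exact hxb
  exact h₂.ne (h.interRel_anti h₄ hbb)

theorem faceInter_hullRel [Finite α] (h : IsFaceInterval pos neg T T') :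
    faceInter pos neg (hullRel T T') = interRel T T' := by
  ext x y
  constructor
  · rintro ⟨⟨hq, h₁⟩, -, h₂⟩
    by_contra hr
    -- The near pair is equivalent in the hull and has exactly the shape of a block, for `maxRel` if
    -- `x < y` and for `minRel` if `y < x`.
    obtain ⟨e, e', hn, he, he', h₃, h₄⟩ := h.exists_near hq hr
    have hee := h.near_hullRel hn
    have hee' := h.near_hullRel hn.symm
    rcases lt_trichotomy x y with hxy | rfl | hxy
    · exact h₂ ⟨e', e, show e' ≤ y by grind [Btw], h₃ hxy, show x ≤ e by grind [Btw], hee', hee,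
        by tauto, by tauto⟩
    · exact hr ⟨h.left.refl x, h.right.refl x⟩
    · exact h₁ ⟨e', e, by grind [Btw], h₄ hxy, by grind [Btw], hee', hee, by tauto, by tauto⟩
  · intro hr
    have hq := IsPermutreeInterval.hullRel_of_interRel hr
    refine ⟨⟨hq, h.not_blocked_of_interRel hr⟩, hq, fun h' => ?_⟩
    refine h.dual.not_blocked_of_interRel (x := x) (y := y) ?_ ?_
    · exact ⟨hr.2, hr.1⟩
    · rw [hullRel_dual]; exact h'

end IsFaceInterval

end Combs

/-! ### Reachability in labeled trees is a permutree preorder. -/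

section LabeledTrees

variable {V : Type}

/-- The vertices joined to `w` by a walk avoiding `v`. -/
def branch (G : SimpleGraph V) (v w : V) : Set V := {x | ∃ q : G.Walk w x, v ∉ q.support}

variable {G : SimpleGraph V}

theorem mem_branch_self {v w : V} (h : v ≠ w) : w ∈ branch G v w :=
  ⟨SimpleGraph.Walk.nil, by simpa using h⟩

theorem ne_of_mem_branch {v w x : V} (h : x ∈ branch G v w) : x ≠ v := by
  obtain ⟨q, hq⟩ := h
  rintro rfl
  exact hq q.end_mem_support

theorem mem_branch_trans {v w x y : V} (h : x ∈ branch G v w) (h' : y ∈ branch G v x) :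
    y ∈ branch G v w := by
  obtain ⟨q, hq⟩ := h
  obtain ⟨q', hq'⟩ := h'
  exact ⟨q.append q', by simp [SimpleGraph.Walk.mem_support_append_iff, hq, hq']⟩

theorem mem_branch_symm {v w x : V} (h : x ∈ branch G v w) : w ∈ branch G v x := by
  obtain ⟨q, hq⟩ := h
  exact ⟨q.reverse, by simpa using hq⟩

theorem mem_branch_of_adj {v w x y : V} (h : x ∈ branch G v w) (hxy : G.Adj x y) (hy : y ≠ v) :
    y ∈ branch G v w := by
  refine mem_branch_trans h ⟨SimpleGraph.Walk.cons hxy SimpleGraph.Walk.nil, ?_⟩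
  have := ne_of_mem_branch h
  simp [this.symm, hy.symm]

theorem eq_of_mem_branch (hG : G.IsAcyclic) {v x y : V} (hx : G.Adj v x) (hy : G.Adj v y)
    (h : y ∈ branch G v x) : x = y := by
  classical
  obtain ⟨q, hq⟩ := h
  have hp : (SimpleGraph.Walk.cons hx q.bypass).IsPath :=
    (SimpleGraph.Walk.cons_isPath_iff _ _).2
      ⟨q.bypass_isPath, fun h => hq (q.support_bypass_subset_support h)⟩
  have hp' : (SimpleGraph.Walk.cons hy SimpleGraph.Walk.nil).IsPath := by
    simp [SimpleGraph.Walk.cons_isPath_iff, hy.ne]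
  have := congrArg (fun p : G.Path v y => p.1.snd) ((hG.subsingleton_path v y).elim ⟨_, hp⟩ ⟨_, hp'⟩)
  simpa using this

/-- Take the last edge along which the walk leaves `S`: the rest of the walk avoids `S`, hence `y`.
-/
theorem exists_exit {S : Set V} {u v : V} (q : G.Walk u v) (hu : u ∈ S) (hv : v ∉ S) :
    ∃ y ∈ S, ∃ z, z ∉ S ∧ G.Adj y z ∧ v ∈ branch G y z := by
  suffices ∃ y ∈ S, ∃ z, z ∉ S ∧ G.Adj y z ∧ ∃ q : G.Walk z v, ∀ t ∈ q.support, t ∉ S by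
    obtain ⟨y, hy, z, hz, hyz, q, hq⟩ := this
    exact ⟨y, hy, z, hz, hyz, q, fun h => hq y h hy⟩
  classical
  induction h : q.length using Nat.strong_induction_on generalizing u q with
  | h n ih =>
    cases q with
    | nil => exact absurd hu hv
    | @cons _ w _ huw q =>
      by_cases hS : ∃ t ∈ q.support, t ∈ S
      · obtain ⟨t, ht, htS⟩ := hS
        refine ih (q.dropUntil t ht).length ?_ (q.dropUntil t ht) htS rfl
        have := q.length_dropUntil_le_length ht
        rw [SimpleGraph.Walk.length_cons] at h
        omega
      · push Not at hS
        exact ⟨u, hu, w, hS w q.start_mem_support, huw, q, hS⟩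

/-- `A` is an orientation of the tree `G`. -/
structure IsOrientedTree (A : V → V → Prop) (G : SimpleGraph V) : Prop where
  adj_iff : ∀ {v w}, G.Adj v w ↔ A v w ∨ A w v
  asymm : ∀ {v w}, A v w → ¬ A w v
  isTree : G.IsTree

namespace IsOrientedTree

variable {A : V → V → Prop}

theorem op (h : IsOrientedTree A G) : IsOrientedTree (fun v w => A w v) G where
  adj_iff := h.adj_iff.trans or_comm
  asymm h₁ h₂ := h.asymm h₁ h₂
  isTree := h.isTree

theorem reflTransGen_op {v w : V} : ReflTransGen (fun v w => A w v) v w ↔ ReflTransGen A w v :=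
  reflTransGen_swap

theorem mem_branch_of_path (h : IsOrientedTree A G) {y y' x : V} (hy : A y y')
    (hp : ReflTransGen A y' x) : x ∈ branch G y y' := by
  have hadj : G.Adj y y' := h.adj_iff.2 (Or.inl hy)
  induction hp with
  | refl => exact mem_branch_self hadj.ne
  | @tail x x' _ hx ih =>
    refine mem_branch_of_adj ih (h.adj_iff.2 (Or.inl hx)) ?_
    rintro rfl
    have := eq_of_mem_branch h.isTree.isAcyclic hadj (h.adj_iff.2 (Or.inr hx)) ih
    subst this
    exact h.asymm hx hy

theorem exists_branch (h : IsOrientedTree A G) {x y : V} (hp : ReflTransGen A y x) (hne : y ≠ x) :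
    ∃ y', A y y' ∧ ReflTransGen A y' x ∧ x ∈ branch G y y' := by
  rcases hp.cases_head with rfl | ⟨y', hy, hp⟩
  · exact absurd rfl hne
  · exact ⟨y', hy, hp, h.mem_branch_of_path hy hp⟩

theorem antisymm (h : IsOrientedTree A G) {v w : V} (h₁ : ReflTransGen A v w)
    (h₂ : ReflTransGen A w v) : v = w := by
  by_contra hne
  obtain ⟨y, hy, hp, -⟩ := h.exists_branch h₁ hne
  exact ne_of_mem_branch (h.mem_branch_of_path hy (hp.trans h₂)) rfl

theorem adj_iff_cover (h : IsOrientedTree A G) {v w : V} :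
    A v w ↔ ReflTransGen A v w ∧ v ≠ w ∧
      ∀ u, ReflTransGen A v u → ReflTransGen A u w → u = v ∨ u = w := by
  constructor
  · intro hA
    refine ⟨ReflTransGen.single hA, (h.adj_iff.2 (Or.inl hA)).ne, fun u h₁ h₂ => ?_⟩
    by_contra! hu
    obtain ⟨y, hy, hp, -⟩ := h.exists_branch h₁ hu.1.symm
    have := eq_of_mem_branch h.isTree.isAcyclic (h.adj_iff.2 (Or.inl hy))
      (h.adj_iff.2 (Or.inl hA)) (h.mem_branch_of_path hy (hp.trans h₂))
    subst this
    exact hu.2 (h.antisymm h₂ hp)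
  · rintro ⟨hp, hne, hc⟩
    obtain ⟨y, hy, hp', -⟩ := h.exists_branch hp hne
    rcases hc y (ReflTransGen.single hy) hp' with rfl | rfl
    · exact absurd hy (fun hy => h.asymm hy hy)
    · exact hy

theorem mem_branch_of_reflTransGen (h : IsOrientedTree A G) {x y z w : V} (hx : x ∈ branch G y z)
    (hp : ReflTransGen A x w) (hxy : ¬ ReflTransGen A x y) : w ∈ branch G y z := by
  induction hp with
  | refl => exact hx
  | @tail w w' h₁ hw ih =>
    refine mem_branch_of_adj ih (h.adj_iff.2 (Or.inl hw)) ?_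
    rintro rfl
    exact hxy (h₁.tail hw)

end IsOrientedTree

variable {α : Type} [LinearOrder α]

/-- Distinct `A`-successors of `v` have branches separated by labels of `v` in `pos`. -/
structure IsSeparated (pos : Set α) (c : α → V) (A : V → V → Prop) (G : SimpleGraph V) : Prop where
  sep : ∀ {v w i j b}, A v w → c i ∈ branch G v w → c j ∈ branch G v w → b ∈ pos → c b = v →
    ¬ Btw i b j
  uniq : ∀ {v w w' i j}, A v w → A v w' → w ≠ w' → c i ∈ branch G v w → c j ∈ branch G v w' →
    ∃ b ∈ pos, c b = v ∧ Btw i b j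

/-- An oriented tree with vertices labeled by the fibers of `c`, satisfying the conditions defining
Schröder permutrees. -/
structure IsLabeledTree (pos neg : Set α) (c : α → V) (A : V → V → Prop) (G : SimpleGraph V) :
    Prop extends IsOrientedTree A G where
  surj : Function.Surjective c
  out : IsSeparated pos c A G
  inc : IsSeparated neg c (fun v w => A w v) G

namespace IsLabeledTree

variable {pos neg : Set α} {c : α → V} {A : V → V → Prop}

theorem op (h : IsLabeledTree pos neg c A G) : IsLabeledTree neg pos c (fun v w => A w v) G where
  toIsOrientedTree := h.toIsOrientedTree.op
  surj := h.surj
  out := h.inc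
  inc := h.out

/-- Otherwise walk from `c b` to `c x` and let `s` be the last vertex that reaches `c b`. The edge
leaving `s` points away from it, and both `x` and `y` lie beyond it. A label of `s` in `pos`, namely
`b` or one separating `x` from `b`, then separates `x` from `y` inside one branch. -/
theorem of_pos (h : IsLabeledTree pos neg c A G) {x b y : α} (hb : Btw x b y) (hp : b ∈ pos)
    (hxy : ReflTransGen A (c x) (c y)) : ReflTransGen A (c x) (c b) := by
  by_contra hc
  obtain ⟨q⟩ := h.isTree.connected.preconnected (c b) (c x)
  obtain ⟨s, hs, z, hz, hsz, hxz⟩ := exists_exit (S := {s | ReflTransGen A s (c b)}) q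
    ReflTransGen.refl hc
  have hA : A s z := (h.adj_iff.1 hsz).resolve_right fun hA => hz (ReflTransGen.head hA hs)
  have hyz : c y ∈ branch G s z :=
    h.mem_branch_of_reflTransGen hxz hxy fun hp => hc (hp.trans hs)
  by_cases hsb : s = c b
  · exact h.out.sep hA hxz hyz hp hsb.symm hb
  · obtain ⟨s', hs', hp', hb'⟩ := h.exists_branch hs hsb
    obtain ⟨d, hd, hds, hd'⟩ := h.out.uniq hA hs' (fun e => hz (e ▸ hp')) hxz hb'
    exact h.out.sep hA hxz hyz hd hds (by grind [Btw])

/-- Here `s` is where the walk from `x` to `y` stops being comparable with `x`. Its incoming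
branches towards `x` and `y` differ, so they are separated by a label of `s` in `neg`. -/
theorem spade_aux (h : IsLabeledTree pos neg c A G) {x y : α} {s z : V}
    (hs : ReflTransGen A (c x) s) (hsz : G.Adj s z)
    (hz : ¬ ReflTransGen A (c x) z) (hz' : ¬ ReflTransGen A z (c x)) (hy : c y ∈ branch G s z) :
    ∃ b, Btw x b y ∧ b ∈ neg ∧ ¬ ReflTransGen A (c b) (c x) ∧ ¬ ReflTransGen A (c b) (c y) := by
  have hA : A z s := (h.adj_iff.1 hsz).resolve_left fun hA => hz (hs.tail hA)
  have hne : s ≠ c x := by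
    rintro rfl
    exact hz' (ReflTransGen.single hA)
  obtain ⟨t, ht, hp, hx⟩ := h.toIsOrientedTree.op.exists_branch
    (IsOrientedTree.reflTransGen_op.2 hs) hne
  rw [IsOrientedTree.reflTransGen_op] at hp
  obtain ⟨b, hb, rfl, hbtw⟩ := h.inc.uniq ht hA (fun e => hz (e ▸ hp)) hx hy
  refine ⟨b, hbtw, hb, fun h' => hne (h.antisymm h' hs), fun h' => ?_⟩
  obtain ⟨r, hr, hp', hy'⟩ := h.exists_branch h' (ne_of_mem_branch hy).symm
  have := eq_of_mem_branch h.isTree.isAcyclic (h.adj_iff.2 (Or.inl hr)) hsz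
    (mem_branch_trans hy' (mem_branch_symm hy))
  subst this
  exact h.asymm hr hA

theorem isPermutreePreorder (h : IsLabeledTree pos neg c A G) :
    IsPermutreePreorder pos neg (fun i j => ReflTransGen A (c i) (c j)) where
  refl _ := ReflTransGen.refl
  trans := ReflTransGen.trans
  of_pos := h.of_pos
  of_neg hb hp hq := IsOrientedTree.reflTransGen_op.1
    (h.op.of_pos hb.symm hp (IsOrientedTree.reflTransGen_op.2 hq))
  spade {x y} h₁ h₂ := by
    obtain ⟨q⟩ := h.isTree.connected.preconnected (c x) (c y)
    obtain ⟨s, hs, z, hz, hsz, hy⟩ :=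
      exists_exit (S := {s | ReflTransGen A (c x) s ∨ ReflTransGen A s (c x)}) q
        (Or.inl ReflTransGen.refl) (by simp [h₁, h₂])
    obtain ⟨hz₁, hz₂⟩ := not_or.1 hz
    rcases hs with hs | hs
    · obtain ⟨b, hb, hn, h'⟩ := h.spade_aux hs hsz hz₁ hz₂ hy
      exact ⟨b, hb, Or.inr ⟨hn, h'⟩⟩
    · have key := h.op.spade_aux (x := x) (y := y) (s := s) (z := z)
      simp only [IsOrientedTree.reflTransGen_op] at key
      obtain ⟨b, hb, hn, h'⟩ := key hs hsz hz₂ hz₁ hy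
      exact ⟨b, hb, Or.inl ⟨hn, h'⟩⟩

end IsLabeledTree

end LabeledTrees

/-! ### The Hasse diagram of a permutree preorder is a labeled tree. -/

section Realization

variable {V α : Type} [LinearOrder α] [PartialOrder V] {pos neg : Set α} {c : α → V}

namespace IsPermutreePreorder

/-- A common lower bound `k` rules out the `neg` alternative: `b` equals `k` or lies between `k` and
one of `i`, `j`, so the relation can be cut at `b`. -/
theorem le_of_spade (h : IsPermutreePreorder pos neg (fun i j => c i ≤ c j)) {k i j b : α}
    (hi : c k ≤ c i) (hj : c k ≤ c j) (hb : Btw i b j)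
    (hs : (b ∈ pos ∧ ¬ c i ≤ c b ∧ ¬ c j ≤ c b) ∨ (b ∈ neg ∧ ¬ c b ≤ c i ∧ ¬ c b ≤ c j)) :
    b ∈ pos ∧ c k ≤ c b ∧ ¬ c i ≤ c b ∧ ¬ c j ≤ c b := by
  have hcase : k = b ∨ Btw k b i ∨ Btw k b j := by grind [Btw]
  rcases hs with ⟨hp, hs⟩ | ⟨hn, hs₁, hs₂⟩
  · refine ⟨hp, ?_, hs⟩
    rcases hcase with rfl | hk | hk
    · exact le_rfl
    · exact h.of_pos hk hp hi
    · exact h.of_pos hk hp hj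
  · exfalso
    rcases hcase with rfl | hk | hk
    · exact hs₁ hi
    · exact hs₁ (h.of_neg hk hn hi)
    · exact hs₂ (h.of_neg hk hn hj)

theorem covBy_unique (h : IsPermutreePreorder pos neg (fun i j => c i ≤ c j))
    (hc : Function.Surjective c) {v w w' u : V} (hw : v ⋖ w) (hw' : v ⋖ w') (hu : w ≤ u)
    (hu' : w' ≤ u) : w = w' := by
  by_contra hne
  obtain ⟨k, rfl⟩ := hc v
  obtain ⟨i, rfl⟩ := hc w
  obtain ⟨j, rfl⟩ := hc w'
  obtain ⟨l, rfl⟩ := hc u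
  obtain ⟨b, hb, hs⟩ := h.spade (x := i) (y := j)
    (fun hij => hw'.2 hw.1 (lt_of_le_of_ne hij hne))
    (fun hij => hw.2 hw'.1 (lt_of_le_of_ne hij (Ne.symm hne)))
  obtain ⟨hp, -, h₁, h₂⟩ := h.le_of_spade hw.1.le hw'.1.le hb hs
  have hcase : l = b ∨ Btw i b l ∨ Btw j b l := by grind [Btw]
  rcases hcase with rfl | hl | hl
  · exact h₁ hu
  · exact h₁ (h.of_pos hl hp hu)
  · exact h₂ (h.of_pos hl hp hu')

/-- Without a separator, a (♠) witness between `i` and `j` is strictly above `v`, hence above a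
cover `w''`; by induction `w = w'' = w'`. -/
theorem exists_separator [Finite α] [Finite V]
    (h : IsPermutreePreorder pos neg (fun i j => c i ≤ c j)) (hc : Function.Surjective c)
    {v w w' : V} (hw : v ⋖ w) (hw' : v ⋖ w') (hne : w ≠ w') {i j : α} (hi : w ≤ c i)
    (hj : w' ≤ c j) : ∃ b ∈ pos, c b = v ∧ Btw i b j := by
  by_contra! hno
  refine hne ?_
  clear hne
  induction i, j using uIcc_induction generalizing w w' with
  | h i j ih =>
    by_cases hij : c i ≤ c j
    · exact h.covBy_unique hc hw hw' (hi.trans hij) hj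
    by_cases hji : c j ≤ c i
    · exact h.covBy_unique hc hw hw' hi (hj.trans hji)
    obtain ⟨k, rfl⟩ := hc v
    obtain ⟨b, hb, hs⟩ := h.spade hij hji
    obtain ⟨hp, hkb, -, -⟩ := h.le_of_spade (hw.1.le.trans hi) (hw'.1.le.trans hj) hb hs
    obtain ⟨w'', hw'', hwb⟩ := exists_covBy_le_of_lt
      (lt_of_le_of_ne hkb fun e => hno b hp e.symm hb)
    rw [ih i b hb.uIcc_left hw hw'' hi hwb fun d hd hd' hd'' => hno d hd hd' (by grind [Btw]),
      ih b j hb.uIcc_right hw'' hw' hwb hj fun d hd hd' hd'' => hno d hd hd' (by grind [Btw])]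

variable {G : SimpleGraph V}

/-- The lower end of an edge jumping across `b` is below `c b`, by the closure property for `pos`.
-/
theorem exists_le_of_crossing (h : IsPermutreePreorder pos neg (fun i j => c i ≤ c j))
    (hc : Function.Surjective c) (hG : ∀ {v w}, G.Adj v w ↔ v ⋖ w ∨ w ⋖ v) {x y : V}
    (q : G.Walk x y) {i j b : α} (hi : c i = x) (hj : c j = y) (hb : Btw i b j) (hp : b ∈ pos) :
    ∃ u ∈ q.support, u ≤ c b := by
  induction q generalizing i with
  | nil => exact ⟨_, by simp, hi ▸ h.of_pos hb hp (le_of_eq (hi.trans hj.symm))⟩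
  | @cons x z y hxz q ih =>
    obtain ⟨l, rfl⟩ := hc z
    have hcase : l = b ∨ Btw i b l ∨ Btw l b j := by grind [Btw]
    rcases hcase with rfl | hl | hl
    · exact ⟨c l, by simp, le_rfl⟩
    · rcases hG.1 hxz with hlt | hlt
      · exact ⟨x, by simp, hi ▸ h.of_pos hl hp (hi ▸ hlt.1.le)⟩
      · exact ⟨c l, by simp, h.of_pos hl.symm hp (hi ▸ hlt.1.le)⟩
    · obtain ⟨u, hu, hub⟩ := ih rfl hj hl
      exact ⟨u, by simp [hu], hub⟩

/-- At a minimal vertex `d` of a cycle both neighbors cover `d`, so a label of `d` in `pos`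
separates them. The rest of the cycle crosses that label and meets a vertex below `d`, which by
minimality is `d` itself. -/
theorem isAcyclic [Finite α] [Finite V]
    (h : IsPermutreePreorder pos neg (fun i j => c i ≤ c j)) (hc : Function.Surjective c)
    (hG : ∀ {v w}, G.Adj v w ↔ v ⋖ w ∨ w ⋖ v) : G.IsAcyclic := by
  classical
  intro v₀ p hp
  obtain ⟨d, hd, hmin⟩ := (p.support.finite_toSet).exists_minimal ⟨v₀, p.start_mem_support⟩
  have hmin' : ∀ u ∈ (p.rotate d hd).support, u ≤ d → u = d := fun u hu hud =>
    le_antisymm hud (hmin ((p.mem_support_rotate_iff d hd).1 hu) hud)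
  have hcyc := hp.rotate hd
  generalize p.rotate d hd = p' at hmin' hcyc
  cases p' with
  | nil => exact hcyc.ne_nil rfl
  | @cons _ x _ hx q =>
    obtain ⟨hq, hedge⟩ := (SimpleGraph.Walk.cons_isCycle_iff q hx).1 hcyc
    have hmin₁ : ∀ u ∈ q.reverse.support, u ≤ d → u = d := fun u hu =>
      hmin' u (by rw [SimpleGraph.Walk.support_cons]; simp_all)
    have hq' := hq.reverse
    have hedge' : s(d, x) ∉ q.reverse.edges := by simpa using hedge
    generalize q.reverse = r at hq' hedge' hmin₁
    cases r with
    | nil => exact hx.ne rfl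
    | @cons _ y _ hy r =>
      have hdr : d ∉ r.support := ((SimpleGraph.Walk.cons_isPath_iff _ _).1 hq').2
      have hcov : ∀ z ∈ r.support, G.Adj d z → d ⋖ z := fun z hz hdz =>
        (hG.1 hdz).resolve_right fun hlt => hlt.1.ne (hmin₁ z (by simp [hz]) hlt.1.le)
      obtain ⟨i, hi⟩ := hc y
      obtain ⟨j, hj⟩ := hc x
      have hyx : y ≠ x := by
        rintro rfl
        simp at hedge'
      obtain ⟨b, hb, hbd, hbtw⟩ := h.exists_separator hc (hcov y r.start_mem_support hy)
        (hcov x r.end_mem_support hx) hyx hi.ge hj.ge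
      obtain ⟨u, hu, hub⟩ := h.exists_le_of_crossing hc hG r hi hj hbtw hb
      have := hmin₁ u (by simp [hu]) (hbd ▸ hub)
      exact hdr (this ▸ hu)

theorem reflTransGen_covBy_iff [Finite V] {v w : V} :
    ReflTransGen (· ⋖ ·) v w ↔ v ≤ w := by
  classical
  cases nonempty_fintype V
  let _ : LocallyFiniteOrder V := Fintype.toLocallyFiniteOrder
  exact le_iff_reflTransGen_covBy.symm

theorem reachable_of_le [Finite V] (hG : ∀ {v w}, G.Adj v w ↔ v ⋖ w ∨ w ⋖ v) {v w : V}
    (hvw : v ≤ w) : G.Reachable v w := by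
  rw [SimpleGraph.reachable_iff_reflTransGen]
  exact (ReflTransGen.mono fun _ _ hlt => hG.2 (Or.inl hlt)) _ _ (reflTransGen_covBy_iff.2 hvw)

theorem isOrientedTree [Finite α] [Finite V] [Nonempty V]
    (h : IsPermutreePreorder pos neg (fun i j => c i ≤ c j)) (hc : Function.Surjective c)
    (hG : ∀ {v w}, G.Adj v w ↔ v ⋖ w ∨ w ⋖ v) : IsOrientedTree (· ⋖ ·) G where
  adj_iff := hG
  asymm h₁ h₂ := h₁.1.not_gt h₂.1
  isTree := by
    refine ⟨⟨fun v w => ?_⟩, h.isAcyclic hc hG⟩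
    obtain ⟨i, rfl⟩ := hc v
    obtain ⟨j, rfl⟩ := hc w
    induction i, j using uIcc_induction with
    | h i j ih =>
      by_cases hij : c i ≤ c j
      · exact reachable_of_le hG hij
      by_cases hji : c j ≤ c i
      · exact (reachable_of_le hG hji).symm
      obtain ⟨b, hb, -⟩ := h.spade hij hji
      exact (ih i b hb.uIcc_left).trans (ih b j hb.uIcc_right)

theorem isSeparated [Finite α] [Finite V] [Nonempty V]
    (h : IsPermutreePreorder pos neg (fun i j => c i ≤ c j)) (hc : Function.Surjective c)
    (hG : ∀ {v w}, G.Adj v w ↔ v ⋖ w ∨ w ⋖ v) : IsSeparated pos c (· ⋖ ·) G := by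
  classical
  have hT := h.isOrientedTree hc hG
  have hsep : ∀ {v w i j b}, v ⋖ w → c i ∈ branch G v w → c j ∈ branch G v w → b ∈ pos →
      c b = v → ¬ Btw i b j := by
    intro v w i j b hvw hi hj hb hbv hbtw
    obtain ⟨q, hq⟩ := mem_branch_trans (mem_branch_symm hi) hj
    -- A walk inside the branch above `v` would meet some `u ≤ v`, but vertices below `v` lie in
    -- branches through lower neighbors.
    obtain ⟨u, hu, hub⟩ := h.exists_le_of_crossing hc hG q rfl rfl hbtw hb
    rw [hbv] at hub
    have huw : u ∈ branch G v w := mem_branch_trans hi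
      ⟨q.takeUntil u hu, fun h' => hq (q.support_takeUntil_subset_support hu h')⟩
    obtain ⟨y, hy, -, hu'⟩ := hT.op.exists_branch
      (IsOrientedTree.reflTransGen_op.2 (reflTransGen_covBy_iff.2 hub)) (ne_of_mem_branch huw).symm
    have := eq_of_mem_branch hT.isTree.isAcyclic (hG.2 (Or.inr hy)) (hG.2 (Or.inl hvw))
      (mem_branch_trans hu' (mem_branch_symm huw))
    subst this
    exact hT.asymm hy hvw
  refine ⟨hsep, fun {v w w' i j} hw hw' hne hi hj => ?_⟩
  obtain ⟨k, rfl⟩ := hc w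
  obtain ⟨l, rfl⟩ := hc w'
  obtain ⟨b, hb, hbv, hbtw⟩ := h.exists_separator hc hw hw' hne le_rfl le_rfl
  have h₁ := hsep hw hi (mem_branch_self hw.1.ne) hb hbv
  have h₂ := hsep hw' hj (mem_branch_self hw'.1.ne) hb hbv
  have h₃ : i ≠ b := fun e => ne_of_mem_branch hi (e ▸ hbv)
  have h₄ : j ≠ b := fun e => ne_of_mem_branch hj (e ▸ hbv)
  exact ⟨b, hb, hbv, by grind [Btw]⟩

theorem isLabeledTree [Finite α] [Finite V] [Nonempty V]
    (h : IsPermutreePreorder pos neg (fun i j => c i ≤ c j)) (hc : Function.Surjective c)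
    (hG : ∀ {v w}, G.Adj v w ↔ v ⋖ w ∨ w ⋖ v) : IsLabeledTree pos neg c (· ⋖ ·) G where
  toIsOrientedTree := h.isOrientedTree hc hG
  surj := hc
  out := h.isSeparated hc hG
  inc := by
    have := isSeparated (V := Vᵒᵈ) (G := G) h.op hc (fun {v w} =>
      (hG (v := OrderDual.ofDual v) (w := OrderDual.ofDual w)).trans (or_comm.trans
        (or_congr toDual_covBy_toDual_iff.symm toDual_covBy_toDual_iff.symm)))
    refine ⟨fun h₁ => this.sep (toDual_covBy_toDual_iff.2 h₁),
      fun h₁ h₂ => this.uniq (toDual_covBy_toDual_iff.2 h₁) (toDual_covBy_toDual_iff.2 h₂)⟩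

end IsPermutreePreorder

end Realization

/-- The cover relation of a relation. -/
def Cover {V : Type} (le : V → V → Prop) (v w : V) : Prop :=
  le v w ∧ v ≠ w ∧ ∀ u, le v u → le u w → u = v ∨ u = w

/-- The Hasse diagram of a relation. -/
def hasseDigraph {V : Type} (le : V → V → Prop) : Digraph V := ⟨Cover le⟩

/-- The Hasse diagram of the quotient of a permutree preorder is a labeled tree. -/
theorem IsPermutreePreorder.isLabeledTree_hasseDigraph {V α : Type} [LinearOrder α] [Finite α]
    [Nonempty V] {pos neg : Set α} {c : α → V} {le : V → V → Prop}
    (h : IsPermutreePreorder pos neg (fun i j => le (c i) (c j))) (hc : Function.Surjective c)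
    (anti : ∀ {v w}, le v w → le w v → v = w) :
    IsLabeledTree pos neg c (Cover le) (hasseDigraph le).toSimpleGraphInclusive ∧
      ∀ {v w}, ReflTransGen (Cover le) v w ↔ le v w := by
  let _ : PartialOrder V :=
    { le := le
      le_refl := fun v => by
        obtain ⟨i, rfl⟩ := hc v
        exact h.refl i
      le_trans := fun v w u => by
        obtain ⟨i, rfl⟩ := hc v
        obtain ⟨j, rfl⟩ := hc w
        obtain ⟨k, rfl⟩ := hc u
        exact h.trans
      le_antisymm := fun v w => anti }
  have : Finite V := Finite.of_surjective c hc
  have hcov : Cover le = fun v w : V => v ⋖ w := by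
    ext v w
    constructor
    · rintro ⟨h₁, h₂, h₃⟩
      exact ⟨lt_of_le_of_ne h₁ h₂, fun u h₄ h₅ => (h₃ u h₄.le h₅.le).elim h₄.ne' h₅.ne⟩
    · intro hvw
      exact ⟨hvw.1.le, hvw.1.ne, fun u h₄ h₅ => hvw.eq_or_eq h₄ h₅⟩
  have hG : ∀ {v w}, (hasseDigraph le).toSimpleGraphInclusive.Adj v w ↔ v ⋖ w ∨ w ⋖ v := by
    intro v w
    simp only [Digraph.toSimpleGraphInclusive, SimpleGraph.fromRel_adj, hasseDigraph, hcov]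
    exact ⟨And.right, fun h' => ⟨h'.elim (fun h => h.1.ne) (fun h => h.1.ne'), h'⟩⟩
  have h' : IsPermutreePreorder pos neg (fun i j => c i ≤ c j) := h
  rw [hcov]
  exact ⟨h'.isLabeledTree hc hG, IsPermutreePreorder.reflTransGen_covBy_iff⟩

/-! ### Comb trees are the Hasse diagrams of the extremal posets. -/

section CombTrees

variable {V α : Type} [LinearOrder α]

/-- The edges of the tree obtained from a labeled tree by replacing each vertex by an increasing
chain. -/
def CombAdj (pos neg : Set α) (c : α → V) (A : V → V → Prop) (i j : α) : Prop :=
  (c i = c j ∧ i < j ∧ ∀ k, c k = c i → ¬ (i < k ∧ k < j)) ∨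
    (A (c i) (c j) ∧ IsGreatest {k | c k = c i ∧ ∀ b ∈ pos, c b = c i → ¬ Btw k b j} i ∧
      IsLeast {k | c k = c j ∧ ∀ b ∈ neg, c b = c j → ¬ Btw i b k} j)

/-- Reachability between labels. -/
def labelRel (c : α → V) (A : V → V → Prop) (i j : α) : Prop := ReflTransGen A (c i) (c j)

theorem exists_closest [Finite α] {c : α → V} (pos : Set α) (v : V) {x y : α} (hx : c x = v) :
    ∃ k, c k = v ∧ ∀ b ∈ pos, c b = v → ¬ Btw k b y := by
  induction x, y using uIcc_induction with
  | h x y ih =>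
    by_cases hb : ∃ b ∈ pos, c b = v ∧ Btw x b y
    · obtain ⟨b, -, hbv, hb⟩ := hb
      exact ih b y hb.uIcc_right hbv
    · push Not at hb
      exact ⟨x, hx, hb⟩

namespace IsLabeledTree

variable {G : SimpleGraph V} {pos neg : Set α} {c : α → V} {A : V → V → Prop}

theorem eq_or_eq_of_adj (h : IsLabeledTree pos neg c A G) {i j k : α} (hA : A (c i) (c j))
    (h₁ : labelRel c A i k) (h₂ : labelRel c A k j) : c k = c i ∨ c k = c j :=
  (h.adj_iff_cover.1 hA).2.2 _ h₁ h₂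

theorem le_of_minRel {i k : α}
    (h₁ : minRel pos neg (labelRel c A) i k) (hik : c k = c i) : i ≤ k := by
  by_contra hlt
  have hr : ReflTransGen A (c k) (c i) := hik ▸ ReflTransGen.refl
  exact IsPermutreePreorder.not_minRel (not_le.1 hlt) hr h₁

/-- Anything between `i` and `j` lies in one of their two classes, since `A` is a cover relation;
the extremal choice of `i` and `j` then leaves no room. -/
theorem cover_of_combAdj (h : IsLabeledTree pos neg c A G) {i j : α}
    (hij : CombAdj pos neg c A i j) : Cover (minRel pos neg (labelRel c A)) i j := by
  rcases hij with ⟨hc, hlt, hcons⟩ | ⟨hA, ⟨⟨-, hi⟩, hi'⟩, ⟨-, hj⟩, hj'⟩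
  · have hr : ReflTransGen A (c i) (c j) := hc ▸ ReflTransGen.refl
    refine ⟨minRel_of_le hlt.le hr, hlt.ne, fun k h₁ h₂ => ?_⟩
    have hk : c k = c i := h.antisymm (h₂.1.trans (hc ▸ ReflTransGen.refl)) h₁.1
    have h₃ := le_of_minRel h₁ hk
    have h₄ := le_of_minRel h₂ (hc ▸ hk.symm)
    have := hcons k hk
    grind
  · have hne : c i ≠ c j := (h.adj_iff_cover.1 hA).2.1
    have hQ := h.isPermutreePreorder
    refine ⟨⟨ReflTransGen.single hA, fun ⟨b, b', h₁, h₂, h₃, h₄, h₅, h₆, h₇⟩ => ?_⟩,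
      fun e => hne (e ▸ rfl), fun k h₁ h₂ => ?_⟩
    · have hib := hQ.blocked_left (ReflTransGen.single hA) h₁ h₂ h₃ h₆
      have hbj := hQ.blocked_right (ReflTransGen.single hA) h₁ h₂ h₃ h₇
      have hbb : c b = c b' := h.antisymm h₄ h₅
      rcases h.eq_or_eq_of_adj (k := b) hA hib (h₄.trans hbj) with hb | hb
      · have hbj' : b ≠ j := fun e => hne (e ▸ hb.symm)
        exact hi b (h₆.resolve_right hbj') hb
          (Or.inr ⟨lt_of_le_of_ne h₁ hbj'.symm, h₂.trans_le h₃⟩)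
      · have hbi' : b' ≠ i := fun e => hne (e ▸ hbb.symm.trans hb)
        exact hj b' (h₇.resolve_right hbi') (hbb.symm.trans hb)
          (Or.inr ⟨h₁.trans_lt h₂, lt_of_le_of_ne h₃ hbi'⟩)
    · rcases h.eq_or_eq_of_adj hA h₁.1 h₂.1 with hk | hk
      · left
        have hik := le_of_minRel h₁ hk
        refine le_antisymm (hi' ⟨hk, fun b hb hbi hbtw => ?_⟩) hik
        rcases hbtw with hbtw | hbtw
        · exact hi b hb hbi (Or.inl ⟨hik.trans_lt hbtw.1, hbtw.2⟩)
        · have hr : ∀ {x y : α}, c x = c y → labelRel c A x y := fun e => by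
            rw [labelRel, e]
          exact h₂.2 ⟨b, k, hbtw.1.le, hbtw.2, le_rfl, hr (hbi.trans hk.symm),
            hr (hk.trans hbi.symm), Or.inl hb, Or.inr rfl⟩
      · right
        have hkj := le_of_minRel h₂ hk.symm
        refine le_antisymm hkj (hj' ⟨hk, fun b hb hbj hbtw => ?_⟩)
        rcases hbtw with hbtw | hbtw
        · exact hj b hb hbj (Or.inl ⟨hbtw.1, hbtw.2.trans_le hkj⟩)
        · have hr : ∀ {x y : α}, c x = c y → labelRel c A x y := fun e => by
            rw [labelRel, e]
          exact h₁.2 ⟨k, b, le_rfl, hbtw.1, hbtw.2.le, hr (hk.trans hbj.symm),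
            hr (hbj.trans hk.symm), Or.inr rfl, Or.inl hb⟩

theorem exists_combAdj [Finite α] (h : IsLabeledTree pos neg c A G) {v w : V} (hA : A v w) :
    ∃ i j, c i = v ∧ c j = w ∧ CombAdj pos neg c A i j := by
  have hvw : v ≠ w := (h.adj_iff_cover.1 hA).2.1
  obtain ⟨x, hx⟩ := h.surj v
  obtain ⟨y, hy⟩ := h.surj w
  obtain ⟨i, hi, hi'⟩ := Set.exists_max_image {k | c k = v ∧ ∀ b ∈ pos, c b = v → ¬ Btw k b y} id
    (Set.toFinite _) (exists_closest pos v hx)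
  obtain ⟨j, hj, hj'⟩ := Set.exists_min_image {k | c k = w ∧ ∀ b ∈ neg, c b = w → ¬ Btw k b x} id
    (Set.toFinite _) (exists_closest neg w hy)
  -- No label of `v` in `pos` separates two labels of `w`, so the choice of `i` is independent of
  -- the representative `y`.
  have hpos : ∀ j', c j' = w → ∀ k, c k = v → ((∀ b ∈ pos, c b = v → ¬ Btw k b y) ↔
      ∀ b ∈ pos, c b = v → ¬ Btw k b j') := by
    intro j' hj' k _
    refine forall_congr' fun b => forall_congr' fun hb => forall_congr' fun hbv => not_congr ?_
    have h₁ := h.out.sep (i := y) (j := j') hA (hy ▸ mem_branch_self (hy ▸ hvw))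
      (hj' ▸ mem_branch_self (hj' ▸ hvw)) hb hbv
    have h₂ : b ≠ y := by grind
    have h₃ : b ≠ j' := by grind
    grind [Btw]
  have hneg : ∀ i', c i' = v → ∀ k, c k = w → ((∀ b ∈ neg, c b = w → ¬ Btw k b x) ↔
      ∀ b ∈ neg, c b = w → ¬ Btw i' b k) := by
    intro i' hi' k _
    refine forall_congr' fun b => forall_congr' fun hb => forall_congr' fun hbw => not_congr ?_
    have h₁ := h.inc.sep (i := x) (j := i') hA (hx ▸ mem_branch_self (hx ▸ hvw.symm))
      (hi' ▸ mem_branch_self (hi' ▸ hvw.symm)) hb hbw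
    have h₂ : b ≠ x := by grind
    have h₃ : b ≠ i' := by grind
    grind [Btw]
  have hiv : c i = v := hi.1
  have hjw : c j = w := hj.1
  refine ⟨i, j, hiv, hjw, Or.inr ⟨by rwa [hiv, hjw], ?_, ?_⟩⟩
  · rw [hiv]
    exact ⟨⟨hiv, (hpos j hjw i hiv).1 hi.2⟩, fun k hk => hi' k ⟨hk.1, (hpos j hjw k hk.1).2 hk.2⟩⟩
  · rw [hjw]
    exact ⟨⟨hjw, (hneg i hiv j hjw).1 hj.2⟩, fun k hk => hj' k ⟨hk.1, (hneg i hiv k hk.1).2 hk.2⟩⟩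

theorem combAdj_connected [Finite α] [Nonempty α] (h : IsLabeledTree pos neg c A G) :
    (Digraph.toSimpleGraphInclusive ⟨CombAdj pos neg c A⟩).Connected := by
  set H := Digraph.toSimpleGraphInclusive ⟨CombAdj pos neg c A⟩ with hH
  have hadj : ∀ {i j}, CombAdj pos neg c A i j → H.Adj i j := fun {i j} hij => by
    rw [hH, Digraph.toSimpleGraphInclusive, SimpleGraph.fromRel_adj]
    exact ⟨(h.cover_of_combAdj hij).2.1, Or.inl hij⟩
  have hcls : ∀ i j, c i = c j → H.Reachable i j := by
    intro i j hij
    induction i, j using uIcc_induction with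
    | h i j ih =>
      by_cases hk : ∃ k, c k = c i ∧ Btw i k j
      · obtain ⟨k, hk, hb⟩ := hk
        exact (ih i k hb.uIcc_left hk.symm).trans (ih k j hb.uIcc_right (hk.trans hij))
      · push Not at hk
        rcases lt_trichotomy i j with hlt | rfl | hlt
        · exact (hadj (Or.inl ⟨hij, hlt, fun k h₁ h₂ => hk k h₁ (Or.inl h₂)⟩)).reachable
        · exact SimpleGraph.Reachable.refl _
        · exact (hadj (Or.inl ⟨hij.symm, hlt, fun k h₁ h₂ =>
            hk k (h₁.trans hij.symm) (Or.inr h₂)⟩)).reachable.symm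
  have hedge : ∀ v w, A v w → ∀ i j, c i = v → c j = w → H.Reachable i j := by
    intro v w hA i j hi hj
    obtain ⟨i', j', hi', hj', hc⟩ := h.exists_combAdj hA
    exact ((hcls i i' (hi.trans hi'.symm)).trans (hadj hc).reachable).trans
      (hcls j' j (hj'.trans hj.symm))
  refine ⟨fun i j => ?_⟩
  obtain ⟨q⟩ := h.isTree.connected.preconnected (c i) (c j)
  generalize hv : c i = v at q
  generalize hw : c j = w at q
  induction q generalizing i with
  | nil => exact hcls i j (hv.trans hw.symm)
  | @cons v z w hvz q ih =>
    obtain ⟨k, rfl⟩ := h.surj z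
    refine SimpleGraph.Reachable.trans ?_ (ih k rfl hw)
    rcases h.adj_iff.1 hvz with hA | hA
    · exact hedge _ _ hA i k hv rfl
    · exact (hedge _ _ hA k i rfl hv).symm

theorem minRel_isLabeledTree [Finite α] [Nonempty α] (h : IsLabeledTree pos neg c A G) :
    IsLabeledTree pos neg id (Cover (minRel pos neg (labelRel c A)))
        (hasseDigraph (minRel pos neg (labelRel c A))).toSimpleGraphInclusive ∧
      ∀ {v w}, ReflTransGen (Cover (minRel pos neg (labelRel c A))) v w ↔
        minRel pos neg (labelRel c A) v w :=
  IsPermutreePreorder.isLabeledTree_hasseDigraph (c := id)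
    h.isPermutreePreorder.isPermutreePreorder_minRel Function.surjective_id
    IsPermutreePreorder.minRel_anti

/-- The comb edges form a connected spanning subgraph of the Hasse tree, which must be the whole
tree since trees are maximal among acyclic graphs. -/
theorem combAdj_iff_cover [Finite α] [Nonempty α] (h : IsLabeledTree pos neg c A G) {i j : α} :
    CombAdj pos neg c A i j ↔ Cover (minRel pos neg (labelRel c A)) i j := by
  refine ⟨h.cover_of_combAdj, fun hij => ?_⟩
  have hT := h.minRel_isLabeledTree.1
  have hle : Digraph.toSimpleGraphInclusive ⟨CombAdj pos neg c A⟩ ≤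
      (hasseDigraph (minRel pos neg (labelRel c A))).toSimpleGraphInclusive :=
    Digraph.toSimpleGraphInclusive_mono fun _ _ => h.cover_of_combAdj
  have hmax := SimpleGraph.isTree_iff_maximal_isAcyclic.1
    ⟨h.combAdj_connected, hT.isTree.isAcyclic.anti hle⟩
  have := hmax.2.2 hT.isTree.isAcyclic hle (hT.adj_iff.2 (Or.inl hij))
  rw [Digraph.toSimpleGraphInclusive, SimpleGraph.fromRel_adj] at this
  exact this.2.resolve_right fun h' => hT.asymm hij (h.cover_of_combAdj h')

end IsLabeledTree

end CombTrees

/-! ### Labeled trees versus permutrees and Schröder permutrees on `Fin n`. -/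

section Translation

variable {n : ℕ} {V : Type} {δ : Orient n}

theorem IsDirectedTree.isOrientedTree {T : Digraph V} (h : IsDirectedTree T) :
    IsOrientedTree T.Adj T.toSimpleGraphInclusive where
  adj_iff {v w} := by
    rw [Digraph.toSimpleGraphInclusive, SimpleGraph.fromRel_adj]
    refine ⟨And.right, fun h' => ⟨?_, h'⟩⟩
    rintro rfl
    exact h'.elim (fun h' => h.1 _ _ h' h') (fun h' => h.1 _ _ h' h')
  asymm := h.1 _ _
  isTree := h.2

theorem IsLabeledTree.dual {α : Type} [LinearOrder α] {G : SimpleGraph V} {pos neg : Set α}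
    {c : α → V} {A : V → V → Prop} (h : IsLabeledTree pos neg c A G) :
    @IsLabeledTree V αᵒᵈ _ pos neg c A G := by
  have key : ∀ {pos : Set α} {A : V → V → Prop}, IsSeparated pos c A G →
      @IsSeparated V αᵒᵈ _ pos c A G := fun {pos A} h =>
    @IsSeparated.mk V αᵒᵈ _ pos c A G
      (fun h₁ h₂ h₃ h₄ h₅ h₆ => h.sep h₁ h₂ h₃ h₄ h₅ (btw_dual.1 h₆))
      (fun h₁ h₂ h₃ h₄ h₅ => by
        obtain ⟨b, hb, hb', hb''⟩ := h.uniq h₁ h₂ h₃ h₄ h₅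
        exact ⟨b, hb, hb', (btw_dual (α := α)).2 hb''⟩)
  exact @IsLabeledTree.mk V αᵒᵈ _ pos neg c A G h.toIsOrientedTree h.surj (key h.out) (key h.inc)

theorem IsLabeledTree.of_dual {α : Type} [LinearOrder α] {G : SimpleGraph V} {pos neg : Set α}
    {c : α → V} {A : V → V → Prop} (h : @IsLabeledTree V αᵒᵈ _ pos neg c A G) :
    IsLabeledTree pos neg c A G := by
  have key : ∀ {pos : Set α} {A : V → V → Prop}, @IsSeparated V αᵒᵈ _ pos c A G →
      IsSeparated pos c A G := fun {pos A} h =>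
    ⟨fun h₁ h₂ h₃ h₄ h₅ h₆ => h.sep h₁ h₂ h₃ h₄ h₅ (btw_dual.2 h₆), fun h₁ h₂ h₃ h₄ h₅ => by
      obtain ⟨b, hb, hb', hb''⟩ := h.uniq h₁ h₂ h₃ h₄ h₅
      exact ⟨b, hb, hb', btw_dual.1 hb''⟩⟩
  exact ⟨h.toIsOrientedTree, h.surj, key h.out, key h.inc⟩

theorem isSeparated_of_one {A : Fin n → Fin n → Prop} {G : SimpleGraph (Fin n)} {pos : Set (Fin n)}
    (one : ∀ b, b ∉ pos → ∀ u v, A b u → A b v → u = v)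
    (left : ∀ b ∈ pos, ∀ u v, A b u → A b v → u < b → v < b → u = v)
    (right : ∀ b ∈ pos, ∀ u v, A b u → A b v → b < u → b < v → u = v)
    (hleft : ∀ b ∈ pos, ∀ u, A b u → u < b → ∀ x ∈ branch G b u, x < b)
    (hright : ∀ b ∈ pos, ∀ u, A b u → b < u → ∀ x ∈ branch G b u, b < x)
    (irrefl : ∀ b, ¬ A b b) : IsSeparated pos id A G where
  sep := by
    rintro v w i j b hA hi hj hb rfl hbtw
    rcases lt_trichotomy w b with hw | rfl | hw
    · have h₁ := hleft b hb w hA hw i hi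
      have h₂ := hleft b hb w hA hw j hj
      grind [Btw]
    · exact irrefl w hA
    · have h₁ := hright b hb w hA hw i hi
      have h₂ := hright b hb w hA hw j hj
      grind [Btw]
  uniq := by
    intro v w w' i j hw hw' hne hi hj
    have hv : v ∈ pos := by
      by_contra hv
      exact hne (one v hv w w' hw hw')
    refine ⟨v, hv, rfl, ?_⟩
    rcases lt_trichotomy w v with h₁ | rfl | h₁
    · rcases lt_trichotomy w' v with h₂ | rfl | h₂
      · exact absurd (left v hv w w' hw hw' h₁ h₂) hne
      · exact absurd hw' (irrefl _)
      · exact Or.inl ⟨hleft v hv w hw h₁ i hi, hright v hv w' hw' h₂ j hj⟩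
    · exact absurd hw (irrefl _)
    · rcases lt_trichotomy w' v with h₂ | rfl | h₂
      · exact Or.inr ⟨hleft v hv w' hw' h₂ j hj, hright v hv w hw h₁ i hi⟩
      · exact absurd hw' (irrefl _)
      · exact absurd (right v hv w w' hw hw' h₁ h₂) hne

theorem IsPermutree.isLabeledTree {T : Digraph (Fin n)} (h : IsPermutree δ T) :
    IsLabeledTree δ.pos δ.neg id T.Adj T.toSimpleGraphInclusive where
  toIsOrientedTree := h.isDirectedTree.isOrientedTree
  surj := Function.surjective_id
  out := isSeparated_of_one h.one_parent h.left_parent h.right_parent h.left_ancestor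
    h.right_ancestor fun b hb => h.isDirectedTree.1 b b hb hb
  inc := isSeparated_of_one h.one_child h.left_child h.right_child h.left_descendant
    h.right_descendant fun b hb => h.isDirectedTree.1 b b hb hb

theorem IsLabeledTree.isPermutree {T : Digraph (Fin n)}
    (h : IsLabeledTree δ.pos δ.neg id T.Adj T.toSimpleGraphInclusive) : IsPermutree δ T := by
  have key : ∀ {pos : Set (Fin n)} {A : Fin n → Fin n → Prop},
      IsSeparated pos id A T.toSimpleGraphInclusive → (∀ {b u}, A b u → b ≠ u) →
      (∀ b, b ∉ pos → ∀ u v, A b u → A b v → u = v) ∧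
      (∀ b ∈ pos, ∀ u v, A b u → A b v → u < b → v < b → u = v) ∧
      (∀ b ∈ pos, ∀ u v, A b u → A b v → b < u → b < v → u = v) ∧
      (∀ b ∈ pos, ∀ u, A b u → u < b → ∀ x ∈ subtree T b u, x < b) ∧
      (∀ b ∈ pos, ∀ u, A b u → b < u → ∀ x ∈ subtree T b u, b < x) := by
    intro pos A hs hne
    have hu : ∀ {b u v}, A b u → A b v → u ≠ v → b ∈ pos ∧ Btw u b v := by
      intro b u v h₁ h₂ h₃
      obtain ⟨d, hd, rfl, hd'⟩ :=
        hs.uniq (i := u) (j := v) h₁ h₂ h₃ (mem_branch_self (hne h₁)) (mem_branch_self (hne h₂))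
      exact ⟨hd, hd'⟩
    have hb : ∀ {b u x}, b ∈ pos → A b u → x ∈ subtree T b u → ¬ Btw u b x ∧ x ≠ b := by
      intro b u x h₁ h₂ h₃
      exact ⟨hs.sep (i := u) (j := x) h₂ (mem_branch_self (hne h₂)) h₃ h₁ rfl, ne_of_mem_branch h₃⟩
    refine ⟨fun b hp u v h₁ h₂ => ?_, fun b hp u v h₁ h₂ h₃ h₄ => ?_,
      fun b hp u v h₁ h₂ h₃ h₄ => ?_, fun b hp u h₁ h₂ x hx => ?_, fun b hp u h₁ h₂ x hx => ?_⟩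
    · by_contra hne'
      exact hp (hu h₁ h₂ hne').1
    · by_contra hne'
      have := (hu h₁ h₂ hne').2
      grind [Btw]
    · by_contra hne'
      have := (hu h₁ h₂ hne').2
      grind [Btw]
    · have := hb hp h₁ hx
      grind [Btw]
    · have := hb hp h₁ hx
      grind [Btw]
  have hirr : ∀ {b u}, T.Adj b u → b ≠ u := fun hA => (h.adj_iff.2 (Or.inl hA)).ne
  obtain ⟨h₁, h₂, h₃, h₄, h₅⟩ := key h.out hirr
  obtain ⟨h₁', h₂', h₃', h₄', h₅'⟩ := key h.inc fun hA => (hirr hA).symm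
  exact ⟨⟨fun _ _ => h.asymm, h.isTree⟩, h₁, h₂, h₃, h₄, h₅, h₁', h₂', h₃', h₄', h₅'⟩

theorem mem_intervalsOfCompl_iff {X I : Set (Fin n)} {y : Fin n} (hy : y ∉ X) :
    (I ∈ intervalsOfCompl X ∧ y ∈ I) ↔ I = Set.ordConnectedComponent Xᶜ y := by
  constructor
  · rintro ⟨⟨z, hz, rfl⟩, h⟩
    exact Set.ordConnectedComponent_eq (Set.mem_ordConnectedComponent.1 h)
  · rintro rfl
    exact ⟨⟨y, hy, rfl⟩, Set.self_mem_ordConnectedComponent.2 hy⟩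

theorem mem_component_iff {X : Set (Fin n)} {x y : Fin n} :
    x ∈ Set.ordConnectedComponent Xᶜ y ↔ x ∉ X ∧ y ∉ X ∧ ∀ b ∈ X, ¬ Btw x b y := by
  rw [Set.mem_ordConnectedComponent]
  constructor
  · intro h
    refine ⟨h Set.right_mem_uIcc, h Set.left_mem_uIcc, fun b hb hbtw => h ?_ hb⟩
    rw [Set.mem_uIcc]
    grind [Btw]
  · rintro ⟨h₁, h₂, h₃⟩ b hb hbX
    rw [Set.mem_uIcc] at hb
    refine h₃ b hbX ?_
    grind [Btw]

/-- Enlarging adds only the elements of `X` bounding the interval, and nothing separates these from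
`y` strictly. -/
theorem mem_enlarge_component {X : Set (Fin n)} {k y : Fin n} (hy : y ∉ X) :
    k ∈ enlarge (Set.ordConnectedComponent Xᶜ y) ↔ ∀ b ∈ X, ¬ Btw k b y := by
  constructor
  · rintro ⟨z, hz, h₁, h₂⟩ b hb hbtw
    obtain ⟨h₃, -, h₄⟩ := mem_component_iff.1 hz
    have h₅ := h₄ b hb
    have h₆ : z ≠ b := fun e => h₃ (e ▸ hb)
    simp only [Btw, Fin.lt_def, Fin.ne_iff_vne] at *
    omega
  · intro h
    by_cases hk : k ∈ X
    · have hne : k ≠ y := fun e => hy (e ▸ hk)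
      rcases lt_or_gt_of_ne hne with hlt | hlt
      · have hz : (k : ℕ) + 1 < n := by
          have := y.2
          simp only [Fin.lt_def] at hlt
          omega
        have key : ∀ b ∈ X, k < b → ¬ b < y := fun b hb h₁ h₂ => h b hb (Or.inl ⟨h₁, h₂⟩)
        refine ⟨⟨k + 1, hz⟩, mem_component_iff.2 ⟨fun hm => ?_, hy, fun b hb hbtw => ?_⟩, ?_, ?_⟩
        · rcases (show (⟨k + 1, hz⟩ : Fin n) ≤ y from hlt).eq_or_lt with e | h'
          · exact hy (e ▸ hm)
          · exact key _ hm (by simp [Fin.lt_def]) h'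
        · refine key b hb ?_ ?_ <;> simp only [Btw, Fin.lt_def] at * <;> omega
        · simp; omega
        · simp
      · have hz : (k : ℕ) - 1 < n := by
          have := k.2
          omega
        have key : ∀ b ∈ X, b < k → ¬ y < b := fun b hb h₁ h₂ => h b hb (Or.inr ⟨h₂, h₁⟩)
        have hpos : 0 < (k : ℕ) := by
          simp only [Fin.lt_def] at hlt
          omega
        refine ⟨⟨k - 1, hz⟩, mem_component_iff.2 ⟨fun hm => ?_, hy, fun b hb hbtw => ?_⟩, ?_, ?_⟩
        · have hle : y ≤ (⟨k - 1, hz⟩ : Fin n) := by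
            simp only [Fin.lt_def, Fin.le_def] at *
            omega
          rcases hle.eq_or_lt with e | h'
          · exact hy (e ▸ hm)
          · exact key _ hm (by simp [Fin.lt_def]; omega) h'
        · refine key b hb ?_ ?_ <;> simp only [Btw, Fin.lt_def] at * <;> omega
        · simp; omega
        · simp; omega
    · exact ⟨k, mem_component_iff.2 ⟨hk, hy, h⟩, by omega, by omega⟩

/-- Both intervals are forced by the edge. The predicates stay free so that the minimal and the
maximal comb share the argument. -/
theorem exists_intervals_iff {S : Digraph V} {c : Fin n → V}
    (h : IsLabeledTree δ.pos δ.neg c S.Adj S.toSimpleGraphInclusive) {i j : Fin n}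
    (hA : S.Adj (c i) (c j)) {Φ Ψ : Set (Fin n) → Prop} :
    (∃ I ∈ intervalsOfCompl ({k | c k = c i} ∩ δ.pos), ∃ J ∈ intervalsOfCompl
      ({k | c k = c j} ∩ δ.neg), {k | c k = c j} ⊆ I ∧ {k | c k = c i} ⊆ J ∧
        Φ ({k | c k = c i} ∩ enlarge I) ∧ Ψ ({k | c k = c j} ∩ enlarge J)) ↔
    Φ {k | c k = c i ∧ ∀ b ∈ δ.pos, c b = c i → ¬ Btw k b j} ∧
      Ψ {k | c k = c j ∧ ∀ b ∈ δ.neg, c b = c j → ¬ Btw i b k} := by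
  have hne : c i ≠ c j := (h.adj_iff_cover.1 hA).2.1
  have hi : i ∉ {k | c k = c j} ∩ δ.neg := fun h' => hne h'.1
  have hj : j ∉ {k | c k = c i} ∩ δ.pos := fun h' => hne h'.1.symm
  have hI : {k | c k = c i} ∩ enlarge (Set.ordConnectedComponent ({k | c k = c i} ∩ δ.pos)ᶜ j) =
      {k | c k = c i ∧ ∀ b ∈ δ.pos, c b = c i → ¬ Btw k b j} := by
    ext k
    refine and_congr Iff.rfl ((mem_enlarge_component hj).trans ?_)
    exact ⟨fun h' b hb hb' => h' b ⟨hb', hb⟩, fun h' b hb => h' b hb.2 hb.1⟩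
  have hJ : {k | c k = c j} ∩ enlarge (Set.ordConnectedComponent ({k | c k = c j} ∩ δ.neg)ᶜ i) =
      {k | c k = c j ∧ ∀ b ∈ δ.neg, c b = c j → ¬ Btw i b k} := by
    ext k
    refine and_congr Iff.rfl ((mem_enlarge_component hi).trans ?_)
    exact ⟨fun h' b hb hb' hbt => h' b ⟨hb', hb⟩ hbt.symm, fun h' b hb hbt => h' b hb.2 hb.1 hbt.symm⟩
  constructor
  · rintro ⟨I, hI', J, hJ', h₁, h₂, h₃, h₄⟩
    obtain rfl := (mem_intervalsOfCompl_iff hj).1 ⟨hI', h₁ rfl⟩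
    obtain rfl := (mem_intervalsOfCompl_iff hi).1 ⟨hJ', h₂ rfl⟩
    exact ⟨hI ▸ h₃, hJ ▸ h₄⟩
  · rintro ⟨h₃, h₄⟩
    refine ⟨_, ((mem_intervalsOfCompl_iff hj).2 rfl).1, _, ((mem_intervalsOfCompl_iff hi).2 rfl).1,
      fun k hk => ?_, fun k hk => ?_, hI.symm ▸ h₃, hJ.symm ▸ h₄⟩
    · refine mem_component_iff.2 ⟨fun h' => hne (h'.1.symm.trans hk), hj, fun b hb => ?_⟩
      exact h.out.sep hA (by rw [show c k = c j from hk]; exact mem_branch_self hne) (mem_branch_self hne) hb.2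
        hb.1
    · refine mem_component_iff.2 ⟨fun h' => hne (hk.symm.trans h'.1), hi, fun b hb => ?_⟩
      exact h.inc.sep hA (by rw [show c k = c i from hk]; exact mem_branch_self hne.symm)
        (mem_branch_self hne.symm) hb.2 hb.1

theorem minPermutree_adj {S : Digraph V} {c : Fin n → V}
    (h : IsLabeledTree δ.pos δ.neg c S.Adj S.toSimpleGraphInclusive) {i j : Fin n} :
    (minPermutree δ S fun v => {k | c k = v}).Adj i j ↔ CombAdj δ.pos δ.neg c S.Adj i j := by
  refine or_congr ?_ ?_
  · constructor
    · rintro ⟨v, rfl, hj, h₁, h₂⟩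
      exact ⟨hj.symm, h₁, h₂⟩
    · rintro ⟨h₁, h₂, h₃⟩
      exact ⟨c i, rfl, h₁.symm, h₂, h₃⟩
  · constructor
    · rintro ⟨v, w, hA, I, hI, J, hJ, h₁, h₂, h₃, h₄⟩
      obtain rfl : c i = v := h₃.1.1
      obtain rfl : c j = w := h₄.1.1
      exact ⟨hA, (exists_intervals_iff h hA (Φ := fun s => IsGreatest s i)
        (Ψ := fun s => IsLeast s j)).1 ⟨I, hI, J, hJ, h₁, h₂, h₃, h₄⟩⟩
    · rintro ⟨hA, h'⟩
      exact ⟨c i, c j, hA, (exists_intervals_iff h hA (Φ := fun s => IsGreatest s i)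
        (Ψ := fun s => IsLeast s j)).2 h'⟩

theorem maxPermutree_adj {S : Digraph V} {c : Fin n → V}
    (h : IsLabeledTree δ.pos δ.neg c S.Adj S.toSimpleGraphInclusive) {i j : Fin n} :
    (maxPermutree δ S fun v => {k | c k = v}).Adj i j ↔
      @CombAdj V (Fin n)ᵒᵈ _ δ.pos δ.neg c S.Adj i j := by
  refine or_congr ?_ ?_
  · constructor
    · rintro ⟨v, hj, rfl, h₁, h₂⟩
      exact ⟨hj.symm, h₁, fun k hk hk' => h₂ k hk ⟨hk'.2, hk'.1⟩⟩
    · rintro ⟨h₁, h₂, h₃⟩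
      exact ⟨c i, h₁.symm, rfl, h₂, fun k hk hk' => h₃ k hk ⟨hk'.2, hk'.1⟩⟩
  · have key : ∀ (hA : S.Adj (c i) (c j)), _ := fun hA => exists_intervals_iff h hA
      (Φ := fun s => IsLeast s i) (Ψ := fun s => IsGreatest s j)
    have hset : ∀ {x b y : Fin n}, ¬ @Btw (Fin n)ᵒᵈ _ x b y ↔ ¬ Btw x b y := not_congr btw_dual
    constructor
    · rintro ⟨v, w, hA, I, hI, J, hJ, h₁, h₂, h₃, h₄⟩
      obtain rfl : c i = v := h₃.1.1
      obtain rfl : c j = w := h₄.1.1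
      obtain ⟨h₅, h₆⟩ := (key hA).1 ⟨I, hI, J, hJ, h₁, h₂, h₃, h₄⟩
      exact ⟨hA, ⟨⟨rfl, fun b hb hb' => hset.2 (h₅.1.2 b hb hb')⟩,
        fun k hk => h₅.2 ⟨hk.1, fun b hb hb' => hset.1 (hk.2 b hb hb')⟩⟩,
        ⟨⟨rfl, fun b hb hb' => hset.2 (h₆.1.2 b hb hb')⟩,
        fun k hk => h₆.2 ⟨hk.1, fun b hb hb' => hset.1 (hk.2 b hb hb')⟩⟩⟩
    · rintro ⟨hA, h₅, h₆⟩
      refine ⟨c i, c j, hA, (key hA).2 ⟨⟨⟨rfl, fun b hb hb' => hset.1 (h₅.1.2 b hb hb')⟩,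
        fun k hk => h₅.2 ⟨hk.1, fun b hb hb' => hset.2 (hk.2 b hb hb')⟩⟩,
        ⟨⟨rfl, fun b hb hb' => hset.1 (h₆.1.2 b hb hb')⟩,
        fun k hk => h₆.2 ⟨hk.1, fun b hb hb' => hset.2 (hk.2 b hb hb')⟩⟩⟩⟩

theorem isSeparated_of_intervals {S : Digraph V} {A : V → V → Prop} {c : Fin n → V}
    {pos : Set (Fin n)} (hne : ∀ {v w}, A v w → v ≠ w)
    (hsub : ∀ v w, A v w → ∃ I ∈ intervalsOfCompl ({k | c k = v} ∩ pos),
      ∀ x ∈ subtree S v w, {k | c k = x} ⊆ I)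
    (huniq : ∀ v, ∀ I ∈ intervalsOfCompl ({k | c k = v} ∩ pos), ∀ w w', A v w → A v w' →
      {k | c k = w} ⊆ I → {k | c k = w'} ⊆ I → w = w') :
    IsSeparated pos c A S.toSimpleGraphInclusive where
  sep {v w i j b} hA hi hj hb hbv := by
    obtain ⟨I, ⟨y, hy, rfl⟩, hI⟩ := hsub v w hA
    have h₁ := hI _ hi (show i ∈ {k | c k = c i} from rfl)
    have h₂ := hI _ hj (show j ∈ {k | c k = c j} from rfl)
    rw [Set.ordConnectedComponent_eq (Set.mem_ordConnectedComponent.1 h₂)] at h₁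
    exact (mem_component_iff.1 h₁).2.2 b ⟨hbv, hb⟩
  uniq {v w w' i j} hw hw' hww hi hj := by
    by_contra! hno
    obtain ⟨I, hI, hI'⟩ := hsub v w hw
    obtain ⟨J, hJ, hJ'⟩ := hsub v w' hw'
    have hi' : i ∉ {k | c k = v} ∩ pos := fun h => ne_of_mem_branch hi h.1
    have hj' : j ∉ {k | c k = v} ∩ pos := fun h => ne_of_mem_branch hj h.1
    have h₁ := (mem_intervalsOfCompl_iff hi').1 ⟨hI, hI' _ hi rfl⟩
    have h₂ := (mem_intervalsOfCompl_iff hj').1 ⟨hJ, hJ' _ hj rfl⟩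
    have h₃ : I = J := by
      rw [h₁, h₂]
      exact (Set.ordConnectedComponent_eq (Set.mem_ordConnectedComponent.1
        (mem_component_iff.2 ⟨hi', hj', fun b hb => hno b hb.2 hb.1⟩))).symm
    exact hww (huniq v I hI w w' hw hw' (hI' w (mem_branch_self (hne hw)))
      (h₃ ▸ hJ' w' (mem_branch_self (hne hw'))))

theorem IsSchroderPermutree.exists_isLabeledTree {S : Digraph V} {p : V → Set (Fin n)}
    (h : IsSchroderPermutree δ S p) : ∃ c : Fin n → V, (p = fun v => {k | c k = v}) ∧
      IsLabeledTree δ.pos δ.neg c S.Adj S.toSimpleGraphInclusive := by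
  have hex : ∀ i, ∃ v, i ∈ p v := fun i => by
    have : i ∈ ⋃ v, p v := h.label_cover ▸ Set.mem_univ i
    simpa using this
  choose c hc using hex
  have hp : p = fun v => {k | c k = v} := by
    ext v i
    constructor
    · intro hi
      by_contra hne
      exact Set.disjoint_left.1 (h.label_disjoint _ _ hne) (hc i) hi
    · rintro rfl
      exact hc i
  subst hp
  have hsurj : Function.Surjective c := h.label_nonempty
  have hT := h.isDirectedTree.isOrientedTree
  have hne : ∀ {v w}, S.Adj v w → v ≠ w := fun hA => (hT.adj_iff.2 (Or.inl hA)).ne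
  exact ⟨c, rfl, hT, hsurj, isSeparated_of_intervals hne h.outgoing_subset h.outgoing_unique,
    isSeparated_of_intervals (fun hA => (hne hA).symm) h.incoming_subset h.incoming_unique⟩

theorem IsSeparated.intervals {S : Digraph V} {A : V → V → Prop} {c : Fin n → V}
    {pos : Set (Fin n)} (h : IsSeparated pos c A S.toSimpleGraphInclusive)
    (hc : Function.Surjective c) (hne : ∀ {v w}, A v w → v ≠ w) :
    (∀ v w, A v w → ∃ I ∈ intervalsOfCompl ({k | c k = v} ∩ pos),
      ∀ x ∈ subtree S v w, {k | c k = x} ⊆ I) ∧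
    (∀ v, ∀ I ∈ intervalsOfCompl ({k | c k = v} ∩ pos), ∀ w w', A v w → A v w' →
      {k | c k = w} ⊆ I → {k | c k = w'} ⊆ I → w = w') := by
  constructor
  · intro v w hA
    obtain ⟨y, rfl⟩ := hc w
    have hy : y ∉ {k | c k = v} ∩ pos := fun h' => hne hA h'.1.symm
    refine ⟨_, ⟨y, hy, rfl⟩, ?_⟩
    rintro x hx k rfl
    exact mem_component_iff.2 ⟨fun h' => ne_of_mem_branch hx h'.1, hy, fun b hb =>
      h.sep hA hx (mem_branch_self (hne hA)) hb.2 hb.1⟩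
  · intro v I hI w w' hw hw' h₁ h₂
    by_contra hww
    obtain ⟨i, rfl⟩ := hc w
    obtain ⟨j, rfl⟩ := hc w'
    obtain ⟨b, hb, hbv, hbtw⟩ := h.uniq hw hw' hww (mem_branch_self (hne hw))
      (mem_branch_self (hne hw'))
    have hj : j ∉ {k | c k = v} ∩ pos := fun h' => hne hw' h'.1.symm
    obtain rfl := (mem_intervalsOfCompl_iff hj).1 ⟨hI, h₂ rfl⟩
    exact (mem_component_iff.1 (h₁ rfl)).2.2 b ⟨hbv, hb⟩ hbtw

theorem IsLabeledTree.isSchroderPermutree {S : Digraph V} {c : Fin n → V}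
    (h : IsLabeledTree δ.pos δ.neg c S.Adj S.toSimpleGraphInclusive) :
    IsSchroderPermutree δ S fun v => {k | c k = v} := by
  have hne : ∀ {v w}, S.Adj v w → v ≠ w := fun hA => (h.adj_iff.2 (Or.inl hA)).ne
  obtain ⟨h₁, h₂⟩ := h.out.intervals h.surj hne
  obtain ⟨h₃, h₄⟩ := h.inc.intervals h.surj fun hA => (hne hA).symm
  exact ⟨⟨fun _ _ => h.asymm, h.isTree⟩, h.surj,
    fun v w hvw => Set.disjoint_left.2 fun i hi hi' => hvw (hi.symm.trans hi'),
    Set.eq_univ_of_forall fun i => Set.mem_iUnion.2 ⟨c i, rfl⟩, h₁, h₂, h₃, h₄⟩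

end Translation

/-! ### The permutree order, interval relations and the final equivalence. -/

section WeakOrder

variable {n : ℕ} {V : Type} {δ : Orient n}

/-- A total order on a finite type is enumerated increasingly by `Fin n`. -/
theorem exists_equiv_of_total {β : Type} [Fintype β] (hn : Fintype.card β = n) {le : β → β → Prop}
    (trans : ∀ x y z, le x y → le y z → le x z) (anti : ∀ x y, le x y → le y x → x = y)
    (total : ∀ x y, le x y ∨ le y x) :
    ∃ e : Fin n ≃ β, ∀ u v, e.symm u ≤ e.symm v ↔ le u v := by
  classical
  let _ : LinearOrder β :=
    { le := le
      le_refl := fun x => (total x x).elim id id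
      le_trans := trans
      le_antisymm := anti
      le_total := total
      toDecidableLE := Classical.decRel _ }
  exact ⟨(monoEquivOfFin β hn).toEquiv, fun _ _ => (monoEquivOfFin β hn).symm.le_iff_le⟩

/-- The linear extension of a permutree poset that is minimal in weak order. -/
theorem exists_minimal_linearExtension {pos neg : Set (Fin n)} {T : Fin n → Fin n → Prop}
    (h : IsPermutreePreorder pos neg T) (anti : ∀ {x y}, T x y → T y x → x = y) :
    ∃ σ : Equiv.Perm (Fin n), ∀ u v, σ⁻¹ u ≤ σ⁻¹ v ↔ T u v ∨ (¬ T v u ∧ u ≤ v) := by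
  have trans : ∀ x y z, T x y ∨ (¬ T y x ∧ x ≤ y) → T y z ∨ (¬ T z y ∧ y ≤ z) →
      T x z ∨ (¬ T z x ∧ x ≤ z) := by
    rintro x y z (h₁ | ⟨h₁, h₁'⟩) (h₂ | ⟨h₂, h₂'⟩)
    · exact Or.inl (h.trans h₁ h₂)
    · by_cases hxz : x ≤ z
      · exact Or.inr ⟨fun h' => h₂ (h.trans h' h₁), hxz⟩
      · left
        rcases h₂'.eq_or_lt with rfl | hlt
        · exact h₁
        · exact (h.left_or_right (Or.inr ⟨hlt, not_le.1 hxz⟩) h₁).resolve_right h₂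
    · by_cases hxz : x ≤ z
      · exact Or.inr ⟨fun h' => h₁ (h.trans h₂ h'), hxz⟩
      · left
        rcases h₁'.eq_or_lt with rfl | hlt
        · exact h₂
        · exact (h.left_or_right (Or.inr ⟨not_le.1 hxz, hlt⟩) h₂).resolve_left h₁
    · refine Or.inr ⟨fun h' => ?_, h₁'.trans h₂'⟩
      rcases h₁'.eq_or_lt with rfl | hlt
      · exact h₂ h'
      rcases h₂'.eq_or_lt with rfl | hlt'
      · exact h₁ h'
      exact (h.left_or_right (Or.inr ⟨hlt, hlt'⟩) h').elim h₂ h₁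
  refine exists_equiv_of_total (Fintype.card_fin n) trans ?_ fun x y => ?_
  · rintro x y (h₁ | ⟨h₁, h₁'⟩) (h₂ | ⟨h₂, h₂'⟩)
    · exact anti h₁ h₂
    · exact absurd h₁ h₂
    · exact absurd h₂ h₁
    · exact le_antisymm h₁' h₂'
  · have := le_total x y
    tauto

/-- Backwards, both extensions are taken minimal in weak order; the strict inversions of such an
extension are exactly the decreasing relations of its tree. -/
theorem permutreeLE_iff {T T' : Digraph (Fin n)}
    (hT : IsLabeledTree δ.pos δ.neg id T.Adj T.toSimpleGraphInclusive)
    (hT' : IsLabeledTree δ.pos δ.neg id T'.Adj T'.toSimpleGraphInclusive) :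
    permutreeLE T T' ↔ IsPermutreeInterval δ.pos δ.neg (treeRel T) (treeRel T') := by
  have hP : IsPermutreePreorder δ.pos δ.neg (treeRel T) := hT.isPermutreePreorder
  have hP' : IsPermutreePreorder δ.pos δ.neg (treeRel T') := hT'.isPermutreePreorder
  constructor
  · rintro ⟨σ, σ', hσ, hσ', hle⟩
    have anti : ∀ (τ : Equiv.Perm (Fin n)) (x y : Fin n), τ⁻¹ x ≤ τ⁻¹ y → τ⁻¹ y ≤ τ⁻¹ x → x = y :=
      fun τ x y h₁ h₂ => τ⁻¹.injective (le_antisymm h₁ h₂)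
    refine ⟨hP, hP', hT.antisymm, hT'.antisymm, fun {x y} hxy h => ?_, fun {x y} hyx h => ?_⟩
    · rcases hxy.eq_or_lt with rfl | hlt
      · exact hP.refl x
      refine inc_of_linearExtensions hP hP' (L := fun x y => σ⁻¹ x ≤ σ⁻¹ y)
        (L' := fun x y => σ'⁻¹ x ≤ σ'⁻¹ y) hσ hσ' (anti σ) (fun x y hxy h' => ?_) hlt h
      by_contra hc
      exact hxy.ne (anti σ' x y h'
        (hle (show (y, x) ∈ inversions σ from ⟨hxy.le, (not_le.1 hc).le⟩)).2)
    · rcases hyx.eq_or_lt with rfl | hlt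
      · exact hP'.refl y
      exact inc_of_linearExtensions (α := (Fin n)ᵒᵈ) hP'.dual hP.dual
        (L := fun x y => σ'⁻¹ x ≤ σ'⁻¹ y) (L' := fun x y => σ⁻¹ x ≤ σ⁻¹ y) hσ' hσ (anti σ')
        (fun x y hxy h' => (hle (show (x, y) ∈ inversions σ from ⟨le_of_lt hxy, h'⟩)).2) hlt h
  · intro h
    obtain ⟨σ, hσ⟩ := exists_minimal_linearExtension h.left h.anti_left
    obtain ⟨σ', hσ'⟩ := exists_minimal_linearExtension h.right h.anti_right
    refine ⟨σ, σ', fun u v huv => (hσ u v).2 (Or.inl huv),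
      fun u v huv => (hσ' u v).2 (Or.inl huv), ?_⟩
    rintro ⟨b, a⟩ ⟨h₁, h₂⟩
    refine ⟨h₁, (hσ' b a).2 ?_⟩
    rcases (hσ b a).1 h₂ with h₃ | ⟨-, h₃⟩
    · exact Or.inl (h.dec h₁ h₃)
    · obtain rfl : a = b := le_antisymm h₁ h₃
      exact Or.inl (h.right.refl a)

/-- Any permutree in the interval inherits the increasing relations of `T'` and the decreasing
relations of `T`; conversely, `T` and `T'` themselves belong to the interval. -/
theorem intervalRel_eq_interRel {T T' : Digraph (Fin n)} (hT : IsPermutree δ T)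
    (hT' : IsPermutree δ T') (h : permutreeLE T T') :
    intervalRel δ T T' = interRel (treeRel T) (treeRel T') := by
  have hrefl : ∀ {S : Digraph (Fin n)}, IsPermutree δ S → permutreeLE S S := fun {S} hS => by
    have hS' := hS.isLabeledTree
    exact (permutreeLE_iff hS' hS').2 ⟨hS'.isPermutreePreorder, hS'.isPermutreePreorder,
      hS'.antisymm, hS'.antisymm, fun _ => id, fun _ => id⟩
  ext x y
  constructor
  · intro hxy
    exact ⟨hxy T hT (hrefl hT) h, hxy T' hT' h (hrefl hT')⟩
  · rintro ⟨h₁, h₂⟩ S hS hTS hST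
    rcases le_total x y with hxy | hxy
    · exact ((permutreeLE_iff hS.isLabeledTree hT'.isLabeledTree).1 hST).inc hxy h₂
    · exact ((permutreeLE_iff hT.isLabeledTree hS.isLabeledTree).1 hTS).dec hxy h₁

theorem minPermutree_spec {S : Digraph V} {c : Fin n → V} [Nonempty (Fin n)]
    (h : IsLabeledTree δ.pos δ.neg c S.Adj S.toSimpleGraphInclusive) :
    IsPermutree δ (minPermutree δ S fun v => {k | c k = v}) ∧
      treeRel (minPermutree δ S fun v => {k | c k = v}) =
        minRel δ.pos δ.neg (labelRel c S.Adj) := by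
  have heq : minPermutree δ S (fun v => {k | c k = v}) =
      hasseDigraph (minRel δ.pos δ.neg (labelRel c S.Adj)) := by
    ext i j
    exact (minPermutree_adj h).trans h.combAdj_iff_cover
  obtain ⟨h₁, h₂⟩ := h.minRel_isLabeledTree
  rw [heq]
  refine ⟨IsLabeledTree.isPermutree h₁, ?_⟩
  ext i j
  exact h₂

theorem maxPermutree_spec {S : Digraph V} {c : Fin n → V} [Nonempty (Fin n)]
    (h : IsLabeledTree δ.pos δ.neg c S.Adj S.toSimpleGraphInclusive) :
    IsPermutree δ (maxPermutree δ S fun v => {k | c k = v}) ∧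
      treeRel (maxPermutree δ S fun v => {k | c k = v}) =
        maxRel δ.pos δ.neg (labelRel c S.Adj) := by
  have : Nonempty (Fin n)ᵒᵈ := ‹Nonempty (Fin n)›
  have heq : maxPermutree δ S (fun v => {k | c k = v}) =
      hasseDigraph (maxRel δ.pos δ.neg (labelRel c S.Adj)) := by
    ext i j
    exact (maxPermutree_adj h).trans h.dual.combAdj_iff_cover
  obtain ⟨h₁, h₂⟩ := h.dual.minRel_isLabeledTree
  rw [heq]
  refine ⟨IsLabeledTree.isPermutree h₁.of_dual, ?_⟩
  ext i j
  exact h₂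

theorem faceRel_spec {S : Digraph V} {c : Fin n → V} [Nonempty (Fin n)]
    (h : IsLabeledTree δ.pos δ.neg c S.Adj S.toSimpleGraphInclusive) :
    faceRel δ S (fun v => {k | c k = v}) ∈ PIP δ ∧ faceRel δ S (fun v => {k | c k = v}) =
      IsPermutreePreorder.faceInter δ.pos δ.neg (labelRel c S.Adj) := by
  obtain ⟨h₁, h₂⟩ := minPermutree_spec h
  obtain ⟨h₃, h₄⟩ := maxPermutree_spec h
  have hle : permutreeLE (minPermutree δ S fun v => {k | c k = v})
      (maxPermutree δ S fun v => {k | c k = v}) := by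
    rw [permutreeLE_iff h₁.isLabeledTree h₃.isLabeledTree, h₂, h₄]
    exact h.isPermutreePreorder.isPermutreeInterval
  refine ⟨⟨_, _, h₁, h₃, hle, rfl⟩, ?_⟩
  rw [faceRel, intervalRel_eq_interRel h₁ h₃ hle, h₂, h₄]
  rfl

theorem spadeBtw_iff {R : Fin n → Fin n → Prop} {a c : Fin n} (hac : a < c) :
    SpadeBtw δ.pos δ.neg R a c ↔ Spade δ R a c := by
  have : ∀ b, Btw a b c ↔ a < b ∧ b < c := fun b => by grind [Btw]
  simp only [SpadeBtw, Spade, this, and_assoc]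

theorem clubBtw_iff {R : Fin n → Fin n → Prop} {a c : Fin n} (hac : a < c) :
    ClubBtw R a c ↔ Club R a c := by
  have : ∀ b, Btw a b c ↔ a < b ∧ b < c := fun b => by grind [Btw]
  simp only [ClubBtw, Club, this, and_imp]

theorem spade_or_club_of_mem_PFP {R : Fin n → Fin n → Prop} (h : R ∈ PFP δ) :
    R ∈ PIP δ ∧ ∀ a c : Fin n, a < c → ¬ R a c → ¬ R c a → Spade δ R a c ∨ Club R a c := by
  obtain ⟨V, S, p, hS, rfl⟩ := h
  obtain ⟨c, rfl, hc⟩ := hS.exists_isLabeledTree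
  have : Nonempty V := hc.isTree.connected.nonempty
  have : Nonempty (Fin n) := hc.surj.nonempty
  obtain ⟨h₁, h₂⟩ := faceRel_spec hc
  refine ⟨h₁, fun x y hxy h₃ h₄ => ?_⟩
  rw [h₂] at *
  rw [← spadeBtw_iff hxy, ← clubBtw_iff hxy]
  exact hc.isPermutreePreorder.faceInter_spade_or_club h₃ h₄

/-- Every permutree preorder is the reachability preorder of a labeled tree. -/
theorem IsPermutreePreorder.exists_isLabeledTree [Nonempty (Fin n)] {Q : Fin n → Fin n → Prop}
    (h : IsPermutreePreorder δ.pos δ.neg Q) : ∃ (V : Type) (S : Digraph V) (c : Fin n → V),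
      IsLabeledTree δ.pos δ.neg c S.Adj S.toSimpleGraphInclusive ∧ labelRel c S.Adj = Q := by
  let s : Setoid (Fin n) :=
    ⟨fun i j => Q i j ∧ Q j i, fun i => ⟨h.refl i, h.refl i⟩, And.symm,
      fun h₁ h₂ => ⟨h.trans h₁.1 h₂.1, h.trans h₂.2 h₁.2⟩⟩
  let le : Quotient s → Quotient s → Prop := Quotient.lift₂ Q fun i j i' j' hi hj =>
    propext ⟨fun h' => h.trans hi.2 (h.trans h' hj.1), fun h' => h.trans hi.1 (h.trans h' hj.2)⟩
  have : Nonempty (Quotient s) := ‹Nonempty (Fin n)›.map (Quotient.mk s)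
  obtain ⟨h₁, h₂⟩ := IsPermutreePreorder.isLabeledTree_hasseDigraph (c := Quotient.mk s) (le := le)
    h Quotient.mk_surjective fun {v w} => Quotient.inductionOn₂ v w fun i j hij hji =>
      Quotient.sound ⟨hij, hji⟩
  refine ⟨_, hasseDigraph le, Quotient.mk s, h₁, ?_⟩
  ext i j
  exact h₂

theorem mem_PFP_of_spade_or_club {R : Fin n → Fin n → Prop} (h : R ∈ PIP δ)
    (hsc : ∀ a c : Fin n, a < c → ¬ R a c → ¬ R c a → Spade δ R a c ∨ Club R a c) :
    R ∈ PFP δ := by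
  obtain ⟨T, T', hT, hT', hle, rfl⟩ := h
  -- A tree has a vertex, so membership in `PIP δ` already forces `n ≥ 1`.
  have : Nonempty (Fin n) := hT.isDirectedTree.2.connected.nonempty
  rw [intervalRel_eq_interRel hT hT' hle] at *
  have hI : IsFaceInterval δ.pos δ.neg (treeRel T) (treeRel T') :=
    ⟨(permutreeLE_iff hT.isLabeledTree hT'.isLabeledTree).1 hle, fun {x y} h₁ h₂ => by
      rcases lt_trichotomy x y with hxy | rfl | hxy
      · rw [spadeBtw_iff hxy, clubBtw_iff hxy]
        exact hsc x y hxy h₁ h₂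
      · exact absurd ⟨ReflTransGen.refl, ReflTransGen.refl⟩ h₁
      · refine Or.imp SpadeBtw.symm ClubBtw.symm ?_
        rw [spadeBtw_iff hxy, clubBtw_iff hxy]
        exact hsc y x hxy h₂ h₁⟩
  -- The Schröder permutree has the equivalence classes of the hull as its labels.
  obtain ⟨V, S, c, hc, hcQ⟩ := hI.isPermutreePreorder_hullRel.exists_isLabeledTree
  refine ⟨V, S, _, hc.isSchroderPermutree, ?_⟩
  rw [(faceRel_spec hc).2, hcQ, hI.faceInter_hullRel]

end WeakOrder

end PermutreePosets

theorem mainTheorem8 (n : ℕ) (δ : PermutreePosets.Orient n) (R : Fin n → Fin n → Prop)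
    (hR : IsPartialOrder (Fin n) R) :
    R ∈ PermutreePosets.PFP δ ↔
      R ∈ PermutreePosets.PIP δ ∧
        ∀ a c : Fin n, a < c → ¬ R a c → ¬ R c a →
          PermutreePosets.Spade δ R a c ∨ PermutreePosets.Club R a c :=
  ⟨PermutreePosets.spade_or_club_of_mem_PFP,
    fun h => PermutreePosets.mem_PFP_of_spade_or_club h.1 h.2⟩
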